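/- Let $U\subseteq\mathbb C^2$ be a nonempty open set with coordinates $(x,y)$, let $\partial_x,\partial_y$ be the derivatives with respect to the complex coordinates ($\partial_x=\frac12(\partial_{\mathrm{Re}\,x}-i\,\partial_{\mathrm{Im}\,x})$ and likewise $\partial_y$), let $\mathfrak D$ be the space of differential operators $T=\sum f_{ij}\,\partial_x^i\partial_y^j$ (finite sums, $f_{ij}\in C^\infty(U,\mathbb C)$), acting on $C^\infty(U,\mathbb C)$, and let $\mathfrak D^{(k)}$ be the subspace of operators of order at most $k$. Let $r\ge 2$ and $p,q,k\ge 0$ be integers. Put $$J^1=\partial_x,\quad J^2_p=x^2\partial_x+rxy\,\partial_y-px,\quad J^3_p=x\partial_x-\tfrac p2,\quad J^4=y\partial_y,\quad J^{5+i}=x^i\partial_y\ \ (0\le i\le r),$$ and let $\mathfrak g^{24,r}_p\simeq\mathfrak{gl}_2\ltimes\mathbb C^{r+1}$ be the Lie algebra that they span. Let $\mathcal S^r_{p,q}$ be the linear span of the monomials $x^iy^j$ with $i+rj\le p$ and $0\le j\le q$; let $\mathfrak S^r_{p,q}$ be the space of all $T\in\mathfrak D$ with $T(\mathcal S^r_{p,q})\subseteq\mathcal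 S^r_{p,q}$, and let $\pi^r_{p,q}:\mathfrak S^r_{p,q}\to\operatorname{End}(\mathcal S^r_{p,q})$ be the restriction map. Let $\tilde{\mathfrak S}^r_{p,q}$ be the space of those $T\in\mathfrak S^r_{p,q}$ that have the form $T=\sum_{i+rj\le p,\ j\le q}f_{ij}\,\partial_x^i\partial_y^j$. It is a complement of $\ker\pi^r_{p,q}$ in $\mathfrak S^r_{p,q}$. An operator $T$ has bidegree $(i,j)\in\mathbb Z^2$ if it maps each monomial $x^ay^b$ ($a,b\ge0$) to a multiple of $x^{a+i}y^{b+j}$ (to $0$ if one of these exponents is negative); its $y$-degree is then $j$. Let $\tilde{\mathfrak S}^{r\downarrow}_{p,q}$ be the subspace of $\tilde{\mathfrak S}^r_{p,q}$ spanned by its elements that have a bidegree with nonpositive $y$-degree. (a) The set of all monomials $$(J^{1+\epsilon}_p)^{s}(J^{5+\epsilon r})^j(J^3_p)^n(J^4)^m\quad\text{and}\quad (J^5)^{t}J^{5+i}(J^{5+r})^{j-t-1}(J^3_p)^n(J^4)^m$$ with $\epsilon\in\{0,1\}$, $0\le j\le q$, $0\le s\le p-jr$, $0\le t\le j-1$,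 $1\le i\le r-\delta_{t0}$, $n\ge 0$, $0\le m\le q-j$ and $n+rm\le p-\tilde s-jr$ (where $\tilde s=s$ for the first group and $\tilde s=0$ for the second) is contained in $\mathfrak S^r_{p,q}$, and the projections of these monomials to $\tilde{\mathfrak S}^r_{p,q}$ along $\ker\pi^r_{p,q}$ form a basis of $\tilde{\mathfrak S}^{r\downarrow}_{p,q}$ (distinct operators in the set having distinct projections). If $qr\le p$, then $$\dim\tilde{\mathfrak S}^{r\downarrow}_{p,q}=\frac{(q+1)(q+2)}2\Big((p+1)(p+1-qr)+\frac{qr^2}{12}(3q+1)\Big).$$ (b) Let $\rho^{r,k}_p:\bigoplus_{n=0}^kS^n(\mathfrak g^{24,r}_p)\to\mathfrak D^{(k)}$ be the linear map given on symmetric powers by symmetrized products, $v_1\cdots v_n\mapsto\frac1{n!}\sum_{\sigma}v_{\sigma(1)}\cdots v_{\sigma(n)}$. The set of all monomials $$(J^{1+\epsilon}_p)^{l-j}(J^{5+\epsilon r})^j(J^3_p)^n(J^4)^{t-l-n}\quad\text{and}\quad (J^5)^{s}J^{5+i}(J^{5+r})^{l-s-1}(J^3_p)^n(J^4)^{t-l-n}$$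 with $\epsilon\in\{0,1\}$, $0\le j\le l\le t\le k$, $0\le s\le l-1$, $0\le n\le t-l$ and $1\le i\le r-\delta_{s0}$ (the second group is absent for $l=0$) is a basis of $\operatorname{im}\rho^{r,k}_p$, and exactly $$\frac16(k+1)(k+2)\big((r+2)k+3\big)$$ elements of this basis are differential operators of order $k$. -/

import Mathlib

open scoped ContDiff TensorProduct

noncomputable section

namespace Staircase

open TopologicalSpace

/-- Extension by zero of a function on an open set `U` of `ℂ²`; it only serves to differentiate
at points of `U`. -/
def extend {U : Opens (ℂ × ℂ)} (f : U → ℂ) : ℂ × ℂ → ℂ :=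
  Function.extend Subtype.val f 0

theorem extend_coe {U : Opens (ℂ × ℂ)} (f : U → ℂ) (z : U) : extend f z = f z :=
  Subtype.val_injective.extend_apply f 0 z

theorem extend_congr {U : Opens (ℂ × ℂ)} (f : U → ℂ) (F : ℂ × ℂ → ℂ)
    (h : ∀ z : U, f z = F z) : Set.EqOn (extend f) F U := by
  intro z hz
  exact (extend_coe f ⟨z, hz⟩).trans (h ⟨z, hz⟩)

/-- The smooth complex-valued functions on the open set `U ⊆ ℂ²`, as a subalgebra of all
functions. -/
def smoothSubalgebra (U : Opens (ℂ × ℂ)) : Subalgebra ℂ (U → ℂ) where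
  carrier := {f | ContDiffOn ℝ ∞ (extend f) U}
  mul_mem' {f g} hf hg := (ContDiffOn.mul hf hg).congr
    (extend_congr _ _ fun z => by simp [extend_coe])
  add_mem' {f g} hf hg := (ContDiffOn.add hf hg).congr
    (extend_congr _ _ fun z => by simp [extend_coe])
  algebraMap_mem' c := (contDiffOn_const (c := c)).congr
    (extend_congr _ _ fun z => rfl)

variable (U : Opens (ℂ × ℂ))

/-- The algebra `C^∞(U, ℂ)`. -/
def Smooth : Type := smoothSubalgebra U

instance : CommRing (Smooth U) := inferInstanceAs (CommRing (smoothSubalgebra U))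

instance : Algebra ℂ (Smooth U) := inferInstanceAs (Algebra ℂ (smoothSubalgebra U))

variable {U} in
/-- The function underlying an element of `C^∞(U, ℂ)`. -/
def Smooth.fn (f : Smooth U) : U → ℂ := f.1

/-- The linear operators on `C^∞(U, ℂ)`. -/
abbrev Op : Type := Module.End ℂ (Smooth U)

instance (V : Submodule ℂ (Op U)) : AddCommGroup V := V.addCommGroup

variable {U} in
theorem contDiffOn_extend (f : Smooth U) : ContDiffOn ℝ ∞ (extend f.fn) U := f.2

variable {U} in
theorem differentiableAt_extend (f : Smooth U) (z : U) :
    DifferentiableAt ℝ (extend f.fn) z :=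
  ((contDiffOn_extend f).contDiffAt (U.2.mem_nhds z.2)).differentiableAt (by simp)

/-- The complex (Wirtinger) derivative of `F` at `z` in the direction `v`:
`½ (D_v F - i D_{iv} F)`. For holomorphic `F` it is the complex derivative in the
direction `v`; for `v = (1,0)`, `(0,1)` it is `∂/∂x`, `∂/∂y`, with `x`, `y` the complex
coordinates. -/
def wirtinger (v : ℂ × ℂ) (F : ℂ × ℂ → ℂ) (z : ℂ × ℂ) : ℂ :=
  (1 / 2) * (fderiv ℝ F z v - Complex.I * fderiv ℝ F z (Complex.I • v))

/-- The complex derivative in the direction `v` as a linear operator on `C^∞(U, ℂ)`. -/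
def partialD (v : ℂ × ℂ) : Op U where
  toFun f := ⟨fun z => wirtinger v (extend f.fn) z, by
    have hd : ContDiffOn ℝ ∞ (fderiv ℝ (extend f.fn)) U :=
      (contDiffOn_extend f).fderiv_of_isOpen U.2 (by simp)
    have h : ContDiffOn ℝ ∞ (wirtinger v (extend f.fn)) U :=
      contDiffOn_const.mul ((hd.clm_apply contDiffOn_const).sub
        (contDiffOn_const.mul (hd.clm_apply contDiffOn_const)))
    exact h.congr (extend_congr _ _ fun z => rfl)⟩
  map_add' f g := by
    refine Subtype.ext (funext fun z => ?_)
    have hz : (z : ℂ × ℂ) ∈ (U : Set (ℂ × ℂ)) := z.2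
    have e : extend (f + g).fn =ᶠ[nhds (z : ℂ × ℂ)] extend f.fn + extend g.fn :=
      Filter.eventuallyEq_of_mem (U.2.mem_nhds hz) (extend_congr _ _ fun w => by
        rw [Pi.add_apply, extend_coe, extend_coe]; rfl)
    change wirtinger v (extend (f + g).fn) z =
      wirtinger v (extend f.fn) z + wirtinger v (extend g.fn) z
    simp only [wirtinger, e.fderiv_eq,
      fderiv_add (differentiableAt_extend f z) (differentiableAt_extend g z), add_apply]
    ring
  map_smul' c f := by
    refine Subtype.ext (funext fun z => ?_)
    have hz : (z : ℂ × ℂ) ∈ (U : Set (ℂ × ℂ)) := z.2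
    have e : extend (c • f).fn =ᶠ[nhds (z : ℂ × ℂ)] c • extend f.fn :=
      Filter.eventuallyEq_of_mem (U.2.mem_nhds hz) (extend_congr _ _ fun w => by
        rw [Pi.smul_apply, extend_coe]; rfl)
    change wirtinger v (extend (c • f).fn) z = c * wirtinger v (extend f.fn) z
    simp only [wirtinger, e.fderiv_eq, fderiv_const_smul (differentiableAt_extend f z),
      smul_apply, smul_eq_mul]
    ring

/-- `∂_x`. -/
def dx : Op U := partialD U (1, 0)

/-- `∂_y`. -/
def dy : Op U := partialD U (0, 1)

/-- The coordinate function `x`. -/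
def X : Smooth U := ⟨fun z => (z : ℂ × ℂ).1,
  contDiff_fst.contDiffOn.congr (extend_congr _ _ fun _ => rfl)⟩

/-- The coordinate function `y`. -/
def Y : Smooth U := ⟨fun z => (z : ℂ × ℂ).2,
  contDiff_snd.contDiffOn.congr (extend_congr _ _ fun _ => rfl)⟩

variable {U} in
/-- The operator of multiplication by the function `f`. -/
def mulOp (f : Smooth U) : Op U := LinearMap.mulLeft ℂ f

/-- The operators `∑ f_{ij} ∂_x^i ∂_y^j` (finite sums, smooth coefficients `f_{ij}`) that only
involve the exponents `(i, j)` satisfying `P`. -/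
def diffOpOn (P : ℕ → ℕ → Prop) : Submodule ℂ (Op U) :=
  Submodule.span ℂ {T | ∃ (f : Smooth U) (i j : ℕ), P i j ∧ T = mulOp f * dx U ^ i * dy U ^ j}

/-- The space `𝔇` of all differential operators on `U`. -/
def diffOp : Submodule ℂ (Op U) := diffOpOn U fun _ _ => True

/-- The space `𝔇^{(k)}` of differential operators of order at most `k`. -/
def diffOpLE (k : ℕ) : Submodule ℂ (Op U) := diffOpOn U fun i j => i + j ≤ k

/-- `T` is a differential operator of order exactly `k`. -/
def HasOrder (T : Op U) (k : ℕ) : Prop :=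
  T ∈ diffOpLE U k ∧ ∀ l < k, T ∉ diffOpLE U l

/-- `T` has bidegree `(i, j)`: it maps each `x^a y^b` to a multiple of `x^{a+i} y^{b+j}`
(to `0` if one of the exponents `a + i`, `b + j` is negative). -/
def HasBidegree (T : Op U) (i j : ℤ) : Prop :=
  ∀ a b : ℕ, T (X U ^ a * Y U ^ b) ∈
    Submodule.span ℂ {g | ∃ c d : ℕ, (c : ℤ) = a + i ∧ (d : ℤ) = b + j ∧ g = X U ^ c * Y U ^ d}

/-- The staircase module `𝒮^r_{p,q}`, spanned by the `x^i y^j` with `i + r j ≤ p`, `j ≤ q`. -/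
def stair (r p q : ℕ) : Submodule ℂ (Smooth U) :=
  Submodule.span ℂ {g | ∃ i j : ℕ, i + r * j ≤ p ∧ j ≤ q ∧ g = X U ^ i * Y U ^ j}

/-- The space `𝔖^r_{p,q}` of the differential operators that preserve `𝒮^r_{p,q}`. -/
def preserving (r p q : ℕ) : Submodule ℂ (Op U) where
  carrier := {T | T ∈ diffOp U ∧ ∀ g ∈ stair U r p q, T g ∈ stair U r p q}
  add_mem' hS hT := ⟨add_mem hS.1 hT.1, fun g hg => add_mem (hS.2 g hg) (hT.2 g hg)⟩
  zero_mem' := ⟨zero_mem _, fun _ _ => zero_mem _⟩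
  smul_mem' c _ hT := ⟨Submodule.smul_mem _ c hT.1, fun g hg => Submodule.smul_mem _ c (hT.2 g hg)⟩

/-- `π^r_{p,q} : 𝔖^r_{p,q} → End(𝒮^r_{p,q})`, the restriction of operators to the module. -/
def restr (r p q : ℕ) : preserving U r p q →ₗ[ℂ] Module.End ℂ (stair U r p q) where
  toFun T := (T : Op U).restrict T.2.2
  map_add' _ _ := rfl
  map_smul' _ _ := rfl

/-- The distinguished complement `𝔖̃^r_{p,q}`: the operators in `𝔖^r_{p,q}` of the form
`∑ f_{ij} ∂_x^i ∂_y^j` with `i + r j ≤ p`, `j ≤ q`. -/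
def distinguished (r p q : ℕ) : Submodule ℂ (preserving U r p q) :=
  (diffOpOn U fun i j => i + r * j ≤ p ∧ j ≤ q).comap (preserving U r p q).subtype

/-- The part `𝔖̃^{r↓}_{p,q}` of `𝔖̃^r_{p,q}` of nonpositive `y`-degree, spanned by the homogeneous
elements of bidegree `(i, j)` with `j ≤ 0`. -/
def distinguishedDown (r p q : ℕ) : Submodule ℂ (preserving U r p q) :=
  Submodule.span ℂ {T | T ∈ distinguished U r p q ∧
    ∃ i j : ℤ, j ≤ 0 ∧ HasBidegree U (T : Op U) i j}

/-- The generators `J^1, …, J^{5+r}` of `𝔤^{24,r}_p` (the value at `0` is not used). -/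
def J (r p : ℕ) : ℕ → Op U
  | 0 => 0
  | 1 => dx U
  | 2 => mulOp (X U ^ 2) * dx U + (r : ℂ) • (mulOp (X U * Y U) * dy U) - (p : ℂ) • mulOp (X U)
  | 3 => mulOp (X U) * dx U - ((p : ℂ) / 2) • 1
  | 4 => mulOp (Y U) * dy U
  | i + 5 => mulOp (X U ^ i) * dy U

/-- The Lie algebra `𝔤^{24,r}_p`, as a vector space of operators: the linear span of its
generators. It is a faithful realization of `𝔤𝔩₂ ⋉ ℂ^{r+1}`. -/
def g24 (r p : ℕ) : Submodule ℂ (Op U) :=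
  Submodule.span ℂ {T | ∃ i : ℕ, 1 ≤ i ∧ i ≤ r + 5 ∧ T = J U r p i}

section Symmetrization

variable {A : Type} [Ring A] [Algebra ℂ A]

/-- `(v_1, …, v_n) ↦ (1/n!) ∑_σ v_{σ(1)} ⋯ v_{σ(n)}` for elements of a subspace `V` of an
associative algebra. -/
def symmProd (V : Submodule ℂ A) (n : ℕ) : MultilinearMap ℂ (fun _ : Fin n => V) A :=
  ((n.factorial : ℂ)⁻¹) • ∑ σ : Equiv.Perm (Fin n),
    ((MultilinearMap.mkPiAlgebraFin ℂ n A).compLinearMap fun _ => V.subtype).domDomCongr σ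

theorem symmProd_perm (V : Submodule ℂ A) (n : ℕ) (e : Equiv.Perm (Fin n)) (v : Fin n → V) :
    symmProd V n (fun i => v (e i)) = symmProd V n v := by
  simp only [symmProd, smul_apply, sum_apply,
    MultilinearMap.domDomCongr_apply]
  congr 1
  exact Fintype.sum_equiv (Equiv.mulLeft e) _ _ fun σ => rfl

/-- The linear map `S^n(V) → A` on the `n`-th symmetric power, determined by the inclusion
`V ⊆ A` through symmetrized products. -/
def symmPow (V : Submodule ℂ A) (n : ℕ) : SymmetricPower ℂ (Fin n) V →ₗ[ℂ] A where
  toFun := AddCon.lift _ (PiTensorProduct.lift (symmProd V n)).toAddMonoidHom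
    (AddCon.addConGen_le.2 fun x y h => by
      cases h with
      | perm e f =>
        have h1 := PiTensorProduct.lift.tprod (φ := symmProd V n) f
        have h2 := PiTensorProduct.lift.tprod (φ := symmProd V n) fun i => f (e i)
        exact h1.trans ((symmProd_perm V n e f).symm.trans h2.symm))
  map_add' x y := map_add _ x y
  map_smul' c x := AddCon.induction_on x fun x => by
    exact (PiTensorProduct.lift (symmProd V n)).map_smul c x

/-- On pure symmetric tensors `symmPow` is the symmetrized product. -/
theorem symmPow_tprod (V : Submodule ℂ A) (n : ℕ) (v : Fin n → V) :
    symmPow V n (SymmetricPower.tprod ℂ v) = symmProd V n v :=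
  PiTensorProduct.lift.tprod v

/-- The linear map `⨁_{n ≤ k} S^n(V) → A` with the components `symmPow`. -/
def symmUpTo (V : Submodule ℂ A) (k : ℕ) :
    (∀ n : Fin (k + 1), SymmetricPower ℂ (Fin n) V) →ₗ[ℂ] A :=
  ∑ n : Fin (k + 1), symmPow V n ∘ₗ LinearMap.proj n

end Symmetrization

/-- `ρ^{r,k}_p : ⨁_{n ≤ k} S^n(𝔤𝔩₂ ⋉ ℂ^{r+1}) → 𝔇`. -/
def rho (r p k : ℕ) :
    (∀ n : Fin (k + 1), SymmetricPower ℂ (Fin n) (g24 U r p)) →ₗ[ℂ] Op U :=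
  symmUpTo (g24 U r p) k

/-- The monomials whose projections are to form a basis of `𝔖̃^{r↓}_{p,q}`. -/
def effMonomials (r p q : ℕ) : Set (Op U) :=
  {T | ∃ ε s j n m : ℕ, ε ≤ 1 ∧ j ≤ q ∧ s + j * r ≤ p ∧ m + j ≤ q ∧ n + r * m + s + j * r ≤ p ∧
      T = J U r p (ε + 1) ^ s * J U r p (ε * r + 5) ^ j * J U r p 3 ^ n * J U r p 4 ^ m} ∪
  {T | ∃ t i j n m : ℕ, j ≤ q ∧ t + 1 ≤ j ∧ 1 ≤ i ∧ i ≤ (if t = 0 then r - 1 else r) ∧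
      m + j ≤ q ∧ n + r * m + j * r ≤ p ∧
      T = J U r p 5 ^ t * J U r p (i + 5) * J U r p (r + 5) ^ (j - t - 1) *
        J U r p 3 ^ n * J U r p 4 ^ m}

/-- The monomials that are to form a basis of the image of `ρ^{r,k}_p`. -/
def bigMonomials (r p k : ℕ) : Set (Op U) :=
  {T | ∃ ε j l t n : ℕ, ε ≤ 1 ∧ j ≤ l ∧ l ≤ t ∧ t ≤ k ∧ n ≤ t - l ∧
      T = J U r p (ε + 1) ^ (l - j) * J U r p (ε * r + 5) ^ j *
        J U r p 3 ^ n * J U r p 4 ^ (t - l - n)} ∪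
  {T | ∃ s i l t n : ℕ, s + 1 ≤ l ∧ l ≤ t ∧ t ≤ k ∧ n ≤ t - l ∧
      1 ≤ i ∧ i ≤ (if s = 0 then r - 1 else r) ∧
      T = J U r p 5 ^ s * J U r p (i + 5) * J U r p (r + 5) ^ (l - s - 1) *
        J U r p 3 ^ n * J U r p 4 ^ (t - l - n)}

end Staircase

end

noncomputable section

namespace Staircase

open TopologicalSpace Finset

variable {U : Opens (ℂ × ℂ)}

/-! A differential operator is determined by its values on the monomials `x^a y^b`
(`eq_zero_of_mon`). The operators that matter are weighted shifts `x^a y^b ↦ c(a,b) x^(a+d) y^(b-j)`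
(`IsHom`) with polynomial weight `c`, so both halves of the theorem become statements about
polynomials in `(a,b)`.

For each `d ∈ ℤ` and `j ≥ 0` there is one leading product `lead` of bidegree `(d,-j)` in the
generators other than `J^3`, `J^4`. The two families of monomials together are the products `lead ·
(J^3)^n (J^4)^m`, with weight `leadCoeff · (a - p/2)^n b^m`. Here `leadCoeff` is a product of linear
factors, and each bound on the exponents is a bound on `n`, `m` for given `(d,j)`
(`effMonomials_eq`, `bigMonomials_eq`).

For (a), inclusion-exclusion produces matrix units of the staircase module inside the distinguished
space. Those that do not raise the `y`-exponent form a basis of the downward part, and counting them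
gives the dimension. In bidegree `(d,-j)`, `leadCoeff` is nonzero at a staircase point exactly when
that point lies in the translate by `(lowering d, j)` of a finite lower set `D` (`exponents`), and
the allowed `(n,m)` run over the same `D`. A polynomial with exponents in `D` takes arbitrary values
on a translate of `D` and is determined by them (`eq_zero_of_sum_eq_zero`, `exists_interpolation`),
so the monomials restrict to a basis in each bidegree.

For (b), closure under commutators makes symmetrized and ordinary products of length at most `k`
span the same space (`range_symmUpTo`). Left multiplication by a generator turns `lead` times a
polynomial into another `lead` times a polynomial and raises the total degree by at most one
(`J_mul_basisMonomial_mem`); this gives spanning. Independence is again interpolation, now far from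
the zeros of `leadCoeff`. The order of a monomial is its number of factors, seen from the degree in
`a` of its weight on `x^a y^a`, and the last count is a lattice count. -/

/-! ### Wirtinger derivatives and monomials as smooth functions -/

theorem Smooth.ext_fn {f g : Smooth U} (h : ∀ z, f.fn z = g.fn z) : f = g :=
  Subtype.ext (funext h)

@[simp] theorem fn_mul (f g : Smooth U) (z : U) : (f * g).fn z = f.fn z * g.fn z := rfl

@[simp] theorem fn_add (f g : Smooth U) (z : U) : (f + g).fn z = f.fn z + g.fn z := rfl

@[simp] theorem fn_smul (c : ℂ) (f : Smooth U) (z : U) : (c • f).fn z = c * f.fn z := rfl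

@[simp] theorem fn_zero (z : U) : (0 : Smooth U).fn z = 0 := rfl

theorem fn_partialD (v : ℂ × ℂ) (f : Smooth U) (z : U) :
    (partialD U v f).fn z = wirtinger v (extend f.fn) z := rfl

theorem extend_eventuallyEq (f : U → ℂ) (F : ℂ × ℂ → ℂ) (h : ∀ z : U, f z = F z) (z : U) :
    extend f =ᶠ[nhds (z : ℂ × ℂ)] F :=
  Filter.eventuallyEq_of_mem (U.2.mem_nhds z.2) (extend_congr f F h)

theorem wirtinger_congr {v : ℂ × ℂ} {F G : ℂ × ℂ → ℂ} {z : ℂ × ℂ} (h : F =ᶠ[nhds z] G) :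
    wirtinger v F z = wirtinger v G z := by
  simp only [wirtinger, h.fderiv_eq]

theorem partialD_mul (v : ℂ × ℂ) (f g : Smooth U) :
    partialD U v (f * g) = f * partialD U v g + g * partialD U v f := by
  refine Smooth.ext_fn fun z => ?_
  have e := extend_eventuallyEq (f * g).fn (extend f.fn * extend g.fn)
    (fun w => by rw [Pi.mul_apply, extend_coe, extend_coe]; rfl) z
  rw [fn_partialD, wirtinger_congr e]
  simp only [fn_add, fn_mul, fn_partialD, wirtinger,
    fderiv_mul (differentiableAt_extend f z) (differentiableAt_extend g z), add_apply, smul_apply,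
    extend_coe, smul_eq_mul]
  ring

/-- The complex derivative in the direction `v` as a derivation. -/
def partialDer (v : ℂ × ℂ) : Derivation ℂ (Smooth U) (Smooth U) :=
  Derivation.mk' (partialD U v) fun f g => by
    rw [partialD_mul]; rfl

theorem partialDer_apply (v : ℂ × ℂ) (f : Smooth U) : partialDer v f = partialD U v f := rfl

/-- Since `L (i v) = i L v`, the two halves of the Wirtinger derivative coincide and add up to `L
v`. -/
theorem partialD_linear (v : ℂ × ℂ) (L : ℂ × ℂ →L[ℂ] ℂ) (f : Smooth U)
    (hf : ∀ z : U, f.fn z = L z) : partialD U v f = algebraMap ℂ (Smooth U) (L v) := by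
  refine Smooth.ext_fn fun z => ?_
  rw [fn_partialD, wirtinger_congr (extend_eventuallyEq f.fn (L.restrictScalars ℝ) hf z)]
  simp only [wirtinger, ContinuousLinearMap.fderiv]
  change (1 / 2 : ℂ) * (L v - Complex.I * L (Complex.I • v)) = L v
  rw [map_smul, smul_eq_mul, ← mul_assoc, Complex.I_mul_I]
  ring

/-- Both sides expand into the same four values of the second real derivative, which is symmetric by
smoothness. -/
theorem partialD_comm (v w : ℂ × ℂ) (f : Smooth U) :
    partialD U v (partialD U w f) = partialD U w (partialD U v f) := by
  refine Smooth.ext_fn fun z => ?_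
  have hc : ContDiffAt ℝ ∞ (extend f.fn) z :=
    (contDiffOn_extend f).contDiffAt (U.2.mem_nhds z.2)
  have hs : IsSymmSndFDerivAt ℝ (extend f.fn) z := hc.isSymmSndFDerivAt (by
    rw [minSmoothness_of_isRCLikeNormedField]; exact WithTop.coe_le_coe.2 le_top)
  have hd : DifferentiableAt ℝ (fderiv ℝ (extend f.fn)) (z : ℂ × ℂ) :=
    (hc.fderiv_right (m := 1) (by exact WithTop.coe_le_coe.2 le_top)).differentiableAt (by simp)
  have key (u s : ℂ × ℂ) : fderiv ℝ (wirtinger u (extend f.fn)) z s =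
      (1 / 2) * (fderiv ℝ (fderiv ℝ (extend f.fn)) z s u
        - Complex.I * fderiv ℝ (fderiv ℝ (extend f.fn)) z s (Complex.I • u)) := by
    have h1 (u : ℂ × ℂ) : HasFDerivAt (fun y => fderiv ℝ (extend f.fn) y u)
        ((fderiv ℝ (fderiv ℝ (extend f.fn)) z).flip u) (z : ℂ × ℂ) := by
      simpa using hd.hasFDerivAt.clm_apply (hasFDerivAt_const u (z : ℂ × ℂ))
    have h2 := ((h1 u).sub ((h1 (Complex.I • u)).const_mul Complex.I)).const_mul (1 / 2 : ℂ)
    have h3 : HasFDerivAt (wirtinger u (extend f.fn)) _ (z : ℂ × ℂ) := h2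
    rw [h3.fderiv]
    simp
  have e (u : ℂ × ℂ) := extend_eventuallyEq (partialD U u f).fn (wirtinger u (extend f.fn))
    (fun y => fn_partialD u f y) z
  rw [fn_partialD, fn_partialD, wirtinger_congr (e w), wirtinger_congr (e v)]
  rw [wirtinger, wirtinger, key, key, key, key, hs v w, hs v (Complex.I • w),
    hs (Complex.I • v) w, hs (Complex.I • v) (Complex.I • w)]
  ring

theorem dx_mul_dy_comm : Commute (dx U) (dy U) :=
  LinearMap.ext fun f => partialD_comm _ _ f

variable (U) in
/-- The monomial `x^a y^b`. -/
def mon (a b : ℕ) : Smooth U := X U ^ a * Y U ^ b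

theorem mon_mul (a b c d : ℕ) : mon U a b * mon U c d = mon U (a + c) (b + d) := by
  simp only [mon, pow_add]; ring

theorem fn_mon (a b : ℕ) (z : U) : (mon U a b).fn z = (z : ℂ × ℂ).1 ^ a * (z : ℂ × ℂ).2 ^ b := rfl

theorem partialD_X (v : ℂ × ℂ) : partialD U v (X U) = algebraMap ℂ _ v.1 :=
  partialD_linear v (ContinuousLinearMap.fst ℂ ℂ ℂ) (X U) fun _ => rfl

theorem partialD_Y (v : ℂ × ℂ) : partialD U v (Y U) = algebraMap ℂ _ v.2 :=
  partialD_linear v (ContinuousLinearMap.snd ℂ ℂ ℂ) (Y U) fun _ => rfl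

theorem partialD_pow (v : ℂ × ℂ) (f : Smooth U) (n : ℕ) :
    partialD U v (f ^ n) = (n : ℂ) • (f ^ (n - 1) * partialD U v f) := by
  rw [← partialDer_apply, ← partialDer_apply, Derivation.leibniz_pow, smul_eq_mul,
    Nat.cast_smul_eq_nsmul]

theorem dx_mon (a b : ℕ) : dx U (mon U a b) = (a : ℂ) • mon U (a - 1) b := by
  rw [dx, mon, partialD_mul, partialD_pow, partialD_pow, partialD_X, partialD_Y]
  simp [mon, mul_comm]

theorem dy_mon (a b : ℕ) : dy U (mon U a b) = (b : ℂ) • mon U a (b - 1) := by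
  rw [dy, mon, partialD_mul, partialD_pow, partialD_pow, partialD_X, partialD_Y]
  simp [mon]

theorem mulOp_mon (a b c d : ℕ) : mulOp (mon U a b) (mon U c d) = mon U (a + c) (b + d) :=
  mon_mul a b c d

theorem dx_pow_mon (i a b : ℕ) :
    (dx U ^ i) (mon U a b) = (a.descFactorial i : ℂ) • mon U (a - i) b := by
  induction i with
  | zero => simp
  | succ i ih =>
    rw [pow_succ', Module.End.mul_apply, ih, map_smul, dx_mon, smul_smul, Nat.descFactorial_succ,
      Nat.sub_sub]
    push_cast
    rw [mul_comm]

theorem dy_pow_mon (i a b : ℕ) :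
    (dy U ^ i) (mon U a b) = (b.descFactorial i : ℂ) • mon U a (b - i) := by
  induction i with
  | zero => simp
  | succ i ih =>
    rw [pow_succ', Module.End.mul_apply, ih, map_smul, dy_mon, smul_smul, Nat.descFactorial_succ,
      Nat.sub_sub]
    push_cast
    rw [mul_comm]

theorem monomialOp_mon (f : Smooth U) (i j a b : ℕ) :
    (mulOp f * dx U ^ i * dy U ^ j) (mon U a b) =
      ((a.descFactorial i : ℂ) * b.descFactorial j) • (f * mon U (a - i) (b - j)) := by
  rw [Module.End.mul_apply, Module.End.mul_apply, dy_pow_mon, map_smul, dx_pow_mon, smul_smul,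
    map_smul, mul_comm]
  rfl

theorem exists_mem_ne_zero (hU : (U : Set (ℂ × ℂ)).Nonempty) :
    ∃ z : U, (z : ℂ × ℂ).1 ≠ 0 ∧ (z : ℂ × ℂ).2 ≠ 0 := by
  have hd : Dense (({0}ᶜ : Set ℂ) ×ˢ ({0}ᶜ : Set ℂ)) :=
    (dense_compl_singleton 0).prod (dense_compl_singleton 0)
  obtain ⟨z, hz, h⟩ := hd.inter_open_nonempty U U.2 hU
  exact ⟨⟨z, hz⟩, h.1, h.2⟩

theorem mon_ne_zero (hU : (U : Set (ℂ × ℂ)).Nonempty) (a b : ℕ) : mon U a b ≠ 0 := by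
  obtain ⟨z, h1, h2⟩ := exists_mem_ne_zero hU
  intro h
  have := fn_mon a b z
  rw [h, fn_zero] at this
  exact mul_ne_zero (pow_ne_zero a h1) (pow_ne_zero b h2) this.symm

/-- The monomials are eigenvectors of `x ∂_x + i y ∂_y`, and the eigenvalues `a + i b` are pairwise
distinct. -/
theorem linearIndependent_mon (hU : (U : Set (ℂ × ℂ)).Nonempty) :
    LinearIndependent ℂ fun α : ℕ × ℕ => mon U α.1 α.2 := by
  refine Module.End.eigenvectors_linearIndependent'
    (mulOp (mon U 1 0) * dx U + Complex.I • (mulOp (mon U 0 1) * dy U))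
    (fun α : ℕ × ℕ => (α.1 : ℂ) + Complex.I * α.2) ?_ _ fun α => ⟨?_, mon_ne_zero hU _ _⟩
  · rintro ⟨a, b⟩ ⟨c, d⟩ h
    have h1 := congrArg Complex.re h
    have h2 := congrArg Complex.im h
    simp at h1 h2
    simp [h1, h2]
  · obtain ⟨a, b⟩ := α
    rw [Module.End.mem_eigenspace_iff, LinearMap.add_apply, LinearMap.smul_apply,
      Module.End.mul_apply, Module.End.mul_apply, dx_mon, dy_mon, map_smul, map_smul, mulOp_mon,
      mulOp_mon, add_smul, mul_smul]
    congr 1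
    · rcases a with _ | a
      · simp
      · congr 2 <;> omega
    · rcases b with _ | b
      · simp
      · congr 3 <;> omega

/-! ### Differential operators: coefficients and the order filtration -/

theorem diffOpOn_mono {P Q : ℕ → ℕ → Prop} (h : ∀ i j, P i j → Q i j) :
    diffOpOn U P ≤ diffOpOn U Q :=
  Submodule.span_mono fun _ ⟨f, i, j, hP, hT⟩ => ⟨f, i, j, h i j hP, hT⟩

theorem monomialOp_mem {P : ℕ → ℕ → Prop} (f : Smooth U) {i j : ℕ} (h : P i j) :
    mulOp f * dx U ^ i * dy U ^ j ∈ diffOpOn U P :=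
  Submodule.subset_span ⟨f, i, j, h, rfl⟩

theorem mulOp_mul_mulOp (f g : Smooth U) : mulOp f * mulOp g = mulOp (f * g) :=
  LinearMap.ext fun h => (mul_assoc f g h).symm

theorem mulOp_add (f g : Smooth U) : mulOp (f + g) = mulOp f + mulOp g :=
  LinearMap.ext fun h => add_mul f g h

theorem mulOp_smul (c : ℂ) (f : Smooth U) : mulOp (c • f) = c • mulOp f :=
  LinearMap.ext fun h => smul_mul_assoc c f h

theorem mulOp_zero : mulOp (0 : Smooth U) = 0 := LinearMap.ext fun h => zero_mul h

theorem mulOp_one : mulOp (1 : Smooth U) = 1 := LinearMap.ext fun h => one_mul h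

theorem mulOp_pow (f : Smooth U) (n : ℕ) : mulOp (f ^ n) = mulOp f ^ n := by
  induction n with
  | zero => rw [pow_zero, pow_zero, mulOp_one]
  | succ n ih => rw [pow_succ, pow_succ, ← mulOp_mul_mulOp, ih]

theorem partialD_mul_mulOp (v : ℂ × ℂ) (f : Smooth U) :
    partialD U v * mulOp f = mulOp (partialD U v f) + mulOp f * partialD U v :=
  LinearMap.ext fun h => by
    refine (partialD_mul v f h).trans ?_
    rw [add_comm, mul_comm]
    rfl

theorem exists_coefficients {P : ℕ → ℕ → Prop} {T : Op U} (hT : T ∈ diffOpOn U P) :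
    ∃ F : ℕ × ℕ →₀ Smooth U, (∀ α, F α ≠ 0 → P α.1 α.2) ∧
      T = F.sum fun α f => mulOp f * dx U ^ α.1 * dy U ^ α.2 := by
  classical
  induction hT using Submodule.span_induction with
  | mem T h =>
    obtain ⟨f, i, j, hP, rfl⟩ := h
    refine ⟨Finsupp.single (i, j) f, fun α hα => ?_, ?_⟩
    · rw [Finsupp.single_apply] at hα
      split_ifs at hα with h
      · rw [← h]; exact hP
      · exact absurd rfl hα
    · rw [Finsupp.sum_single_index]
      rw [mulOp_zero, zero_mul, zero_mul]
  | zero => exact ⟨0, fun α h => absurd rfl h, by simp⟩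
  | add S T _ _ hS hT =>
    obtain ⟨F, hF, rfl⟩ := hS
    obtain ⟨G, hG, rfl⟩ := hT
    refine ⟨F + G, fun α h => ?_, ?_⟩
    · by_cases h' : F α = 0
      · exact hG α fun h'' => h (by rw [Finsupp.add_apply, h', h'', add_zero])
      · exact hF α h'
    · rw [Finsupp.sum_add_index']
      · intro α; rw [mulOp_zero, zero_mul, zero_mul]
      · intro α f g; rw [mulOp_add, add_mul, add_mul]
  | smul c T _ hT =>
    obtain ⟨F, hF, rfl⟩ := hT
    refine ⟨c • F, fun α h => hF α fun h' => h (by rw [Finsupp.smul_apply, h', smul_zero]), ?_⟩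
    rw [Finsupp.sum_smul_index', Finsupp.smul_sum]
    · refine Finsupp.sum_congr fun α _ => ?_
      rw [mulOp_smul, smul_mul_assoc, smul_mul_assoc]
    · intro α; rw [mulOp_zero, zero_mul, zero_mul]

/-- A differential operator is determined by its values at the monomials `x^i y^j` for the exponents
`(i, j)` of the derivatives in it. -/
theorem eq_zero_of_mon {P : ℕ → ℕ → Prop} {T : Op U} (hT : T ∈ diffOpOn U P)
    (h0 : ∀ a b, P a b → T (mon U a b) = 0) : T = 0 := by
  obtain ⟨F, hF, rfl⟩ := exists_coefficients hT
  -- Induction on the total degree of `α`: at `x^α` only the `∂^β` with `β ≤ α` survive. Those with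
  -- `β ≠ α` have zero coefficient by induction, which leaves `α! F(α) = 0`.
  suffices hz : ∀ N, ∀ α : ℕ × ℕ, α.1 + α.2 = N → F α = 0 by
    have : F = 0 := Finsupp.ext fun α => hz _ α rfl
    rw [this, Finsupp.sum_zero_index]
  intro N
  induction N using Nat.strong_induction_on with
  | _ N ih =>
    intro α hα
    by_contra hne
    have h := h0 α.1 α.2 (hF α hne)
    rw [Finsupp.sum, LinearMap.sum_apply, Finset.sum_eq_single α] at h
    · rw [monomialOp_mon, Nat.descFactorial_self, Nat.descFactorial_self, Nat.sub_self,
        Nat.sub_self, smul_eq_zero] at h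
      rcases h with h | h
      · exact mul_ne_zero (Nat.cast_ne_zero.2 (Nat.factorial_ne_zero _))
          (Nat.cast_ne_zero.2 (Nat.factorial_ne_zero _)) h
      · exact hne (by simpa [mon] using h)
    · intro β _ hβ
      rw [monomialOp_mon]
      by_cases h1 : α.1 < β.1
      · rw [Nat.descFactorial_of_lt h1]; simp
      by_cases h2 : α.2 < β.2
      · rw [Nat.descFactorial_of_lt h2]; simp
      have : F β = 0 := by
        refine ih (β.1 + β.2) ?_ β rfl
        by_contra h3
        exact hβ (Prod.ext (by omega) (by omega))
      rw [this, zero_mul, smul_zero]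
    · intro h'
      exact absurd (Finsupp.notMem_support_iff.1 h') hne

theorem eq_of_mon {P : ℕ → ℕ → Prop} {S T : Op U} (hS : S ∈ diffOpOn U P)
    (hT : T ∈ diffOpOn U P) (h : ∀ a b, P a b → S (mon U a b) = T (mon U a b)) : S = T :=
  sub_eq_zero.1 <| eq_zero_of_mon (sub_mem hS hT) fun a b hab => by
    rw [LinearMap.sub_apply, h a b hab, sub_self]

theorem eq_of_mon_of_mem_diffOp {S T : Op U} (hS : S ∈ diffOp U) (hT : T ∈ diffOp U)
    (h : ∀ a b, S (mon U a b) = T (mon U a b)) : S = T :=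
  eq_of_mon hS hT fun a b _ => h a b

theorem diffOpLE_mono {k l : ℕ} (h : k ≤ l) : diffOpLE U k ≤ diffOpLE U l :=
  diffOpOn_mono fun _ _ h' => h'.trans h

theorem diffOpLE_le (k : ℕ) : diffOpLE U k ≤ diffOp U := diffOpOn_mono fun _ _ _ => trivial

theorem mulOp_mul_mem {P : ℕ → ℕ → Prop} (f : Smooth U) {T : Op U} (hT : T ∈ diffOpOn U P) :
    mulOp f * T ∈ diffOpOn U P := by
  induction hT using Submodule.span_induction with
  | mem T h =>
    obtain ⟨g, i, j, h, rfl⟩ := h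
    rw [← mul_assoc, ← mul_assoc, mulOp_mul_mulOp]
    exact monomialOp_mem _ h
  | zero => rw [mul_zero]; exact zero_mem _
  | add S T _ _ hS hT => rw [mul_add]; exact add_mem hS hT
  | smul c T _ hT => rw [mul_smul_comm]; exact Submodule.smul_mem _ c hT

theorem dx_mul_mem {k : ℕ} {T : Op U} (hT : T ∈ diffOpLE U k) : dx U * T ∈ diffOpLE U (k + 1) := by
  induction hT using Submodule.span_induction with
  | mem T h =>
    obtain ⟨g, i, j, h, rfl⟩ := h
    rw [dx, ← mul_assoc, ← mul_assoc, partialD_mul_mulOp, add_mul, add_mul, mul_assoc (mulOp g),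
      ← dx, ← pow_succ']
    exact add_mem (monomialOp_mem _ (by omega)) (monomialOp_mem _ (by omega))
  | zero => rw [mul_zero]; exact zero_mem _
  | add S T _ _ hS hT => rw [mul_add]; exact add_mem hS hT
  | smul c T _ hT => rw [mul_smul_comm]; exact Submodule.smul_mem _ c hT

theorem dy_mul_mem {k : ℕ} {T : Op U} (hT : T ∈ diffOpLE U k) : dy U * T ∈ diffOpLE U (k + 1) := by
  induction hT using Submodule.span_induction with
  | mem T h =>
    obtain ⟨g, i, j, h, rfl⟩ := h
    rw [dy, ← mul_assoc, ← mul_assoc, partialD_mul_mulOp, add_mul, add_mul, mul_assoc (mulOp g),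
      ← dy, ← (dx_mul_dy_comm.pow_left i).eq, ← mul_assoc, mul_assoc _ (dy U), ← pow_succ']
    exact add_mem (monomialOp_mem _ (by omega)) (monomialOp_mem _ (by omega))
  | zero => rw [mul_zero]; exact zero_mem _
  | add S T _ _ hS hT => rw [mul_add]; exact add_mem hS hT
  | smul c T _ hT => rw [mul_smul_comm]; exact Submodule.smul_mem _ c hT

theorem one_mem_diffOpLE (k : ℕ) : (1 : Op U) ∈ diffOpLE U k := by
  have := monomialOp_mem (P := fun i j => i + j ≤ k) (1 : Smooth U) (i := 0) (j := 0) (by omega)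
  simpa [mulOp_one, diffOpLE] using this

/-- Moving a derivative past a coefficient by the Leibniz rule leaves a term without that
derivative, so the order grows by at most one. -/
theorem diffOpLE_one_mul_le (k : ℕ) : diffOpLE U 1 * diffOpLE U k ≤ diffOpLE U (k + 1) := by
  refine Submodule.mul_le.2 fun S hS T hT => ?_
  induction hS using Submodule.span_induction with
  | mem S h =>
    obtain ⟨g, i, j, h, rfl⟩ := h
    rw [mul_assoc, mul_assoc]
    refine mulOp_mul_mem g ?_
    change _ ∈ diffOpLE U (k + 1)
    have h' : (i = 0 ∧ j = 0) ∨ (i = 1 ∧ j = 0) ∨ (i = 0 ∧ j = 1) := by omega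
    rcases h' with ⟨rfl, rfl⟩ | ⟨rfl, rfl⟩ | ⟨rfl, rfl⟩
    · simpa using diffOpLE_mono (Nat.le_succ k) hT
    · simpa using dx_mul_mem hT
    · simpa using dy_mul_mem hT
  | zero => rw [zero_mul]; exact zero_mem _
  | add S S' _ _ hS hS' => rw [add_mul]; exact add_mem hS hS'
  | smul c S _ hS => rw [smul_mul_assoc]; exact Submodule.smul_mem _ c hS

/-- Compares the powers of `V` with a filtration. It serves for the order filtration, for spans of
list products and for spans of the basis monomials. -/
theorem pow_le_of_mul_le {A : Type} [Ring A] [Algebra ℂ A] (V : Submodule ℂ A)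
    (F : ℕ → Submodule ℂ A) (h0 : 1 ∈ F 0) (h : ∀ k, V * F k ≤ F (k + 1)) (k : ℕ) :
    V ^ k ≤ F k := by
  induction k with
  | zero => rw [Submodule.pow_zero, Submodule.one_le]; exact h0
  | succ k ih =>
    rw [pow_succ']
    exact (mul_le_mul' le_rfl ih).trans (h k)

theorem diffOpLE_one_pow_le (k : ℕ) : diffOpLE U 1 ^ k ≤ diffOpLE U k :=
  pow_le_of_mul_le _ _ (one_mem_diffOpLE 0) diffOpLE_one_mul_le k

/-- Along the diagonal, an operator of order at most `l` acts on monomials through a polynomial of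
degree at most `l`. -/
theorem exists_polynomial_diagonal {l : ℕ} {T : Op U} (hT : T ∈ diffOpLE U l) (z : U)
    (h1 : (z : ℂ × ℂ).1 ≠ 0) (h2 : (z : ℂ × ℂ).2 ≠ 0) :
    ∃ Q : Polynomial ℂ, Q.natDegree ≤ l ∧
      ∀ a : ℕ, (T (mon U a a)).fn z = Q.eval (a : ℂ) * (mon U a a).fn z := by
  induction hT using Submodule.span_induction with
  | mem T h =>
    obtain ⟨f, i, j, hij, rfl⟩ := h
    -- `∂_x^i ∂_y^j` contributes falling factorials of `a` of degrees `i` and `j`; at the fixed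
    -- point `z` the lost powers of `x` and `y` become a constant factor.
    refine ⟨Polynomial.C (f.fn z * ((z : ℂ × ℂ).1 ^ i)⁻¹ * ((z : ℂ × ℂ).2 ^ j)⁻¹) *
      (descPochhammer ℂ i * descPochhammer ℂ j), ?_, fun a => ?_⟩
    · refine (Polynomial.natDegree_C_mul_le _ _).trans (Polynomial.natDegree_mul_le.trans ?_)
      rw [descPochhammer_natDegree, descPochhammer_natDegree]
      exact hij
    · rw [monomialOp_mon, fn_smul, fn_mul, fn_mon, fn_mon, Polynomial.eval_mul,
        Polynomial.eval_mul, descPochhammer_eval_eq_descFactorial,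
        descPochhammer_eval_eq_descFactorial, Polynomial.eval_C]
      by_cases hi : a < i
      · rw [Nat.descFactorial_of_lt hi]; simp
      by_cases hj : a < j
      · rw [Nat.descFactorial_of_lt hj]; simp
      obtain ⟨u, rfl⟩ := Nat.exists_eq_add_of_le (not_lt.1 hi)
      obtain ⟨w, hw⟩ := Nat.exists_eq_add_of_le (not_lt.1 hj)
      have e : (z : ℂ × ℂ).2 ^ (i + u) = (z : ℂ × ℂ).2 ^ j * (z : ℂ × ℂ).2 ^ (i + u - j) := by
        rw [← pow_add]; congr 1; omega
      rw [e, Nat.add_sub_cancel_left, pow_add]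
      field_simp
  | zero => exact ⟨0, by simp, fun a => by simp⟩
  | add S T _ _ hS hT =>
    obtain ⟨Q, hQ, hQ'⟩ := hS
    obtain ⟨R, hR, hR'⟩ := hT
    refine ⟨Q + R, Polynomial.natDegree_add_le_of_degree_le hQ hR, fun a => ?_⟩
    rw [LinearMap.add_apply, fn_add, hQ', hR', Polynomial.eval_add, add_mul]
  | smul c T _ hT =>
    obtain ⟨Q, hQ, hQ'⟩ := hT
    refine ⟨c • Q, (Polynomial.natDegree_smul_le _ _).trans hQ, fun a => ?_⟩
    rw [LinearMap.smul_apply, fn_smul, hQ', Polynomial.eval_smul, smul_eq_mul, mul_assoc]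

/-! ### Elementary operators with exponents in a lower set -/

/-- The coefficients of the operator `∑ κ(a, i) x^i ∂_x^i` that is the projection onto `x^a` on
polynomials of bounded degree. -/
def projCoeff (a i : ℕ) : ℂ :=
  if a ≤ i then (-1) ^ (i - a) / (a.factorial * (i - a).factorial) else 0

theorem projCoeff_of_lt {a i : ℕ} (h : i < a) : projCoeff a i = 0 := if_neg (by omega)

/-- The summand is `(-1)^(i-a) C(i,a) C(c,i)`, so this is binomial inversion; after the shift `i = a
+ k` it is the alternating sum of a row of Pascal's triangle. -/
theorem sum_projCoeff_mul_descFactorial (a c : ℕ) :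
    ∑ i ∈ range (c + 1), projCoeff a i * (c.descFactorial i : ℂ) = if c = a then 1 else 0 := by
  rcases lt_or_ge c a with h | h
  · rw [if_neg (by omega)]
    refine Finset.sum_eq_zero fun i hi => ?_
    rw [projCoeff_of_lt (by have := mem_range.1 hi; omega), zero_mul]
  · obtain ⟨n, rfl⟩ := Nat.exists_eq_add_of_le h
    rw [add_assoc, Finset.sum_range_add, Finset.sum_eq_zero, zero_add]
    · have e : ∀ k ∈ range (n + 1), projCoeff a (a + k) * ((a + n).descFactorial (a + k) : ℂ) =
          ((a + n).factorial / (a.factorial * n.factorial)) * ((-1) ^ k * (n.choose k : ℂ)) := by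
        intro k hk
        have hk : k ≤ n := by have := mem_range.1 hk; omega
        rw [projCoeff, if_pos (by omega), Nat.add_sub_cancel_left]
        have h1 : (((a + n) - (a + k)).factorial : ℂ) * ((a + n).descFactorial (a + k) : ℂ) =
            (a + n).factorial := by
          exact_mod_cast Nat.factorial_mul_descFactorial (show a + k ≤ a + n by omega)
        have h2 : (n.choose k : ℂ) * k.factorial * (n - k).factorial = n.factorial := by
          exact_mod_cast Nat.choose_mul_factorial_mul_factorial hk
        have h3 : a + n - (a + k) = n - k := by omega
        rw [h3] at h1
        have hz (m : ℕ) : (m.factorial : ℂ) ≠ 0 := Nat.cast_ne_zero.2 m.factorial_ne_zero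
        rw [← h1, ← h2]
        have hc : (n.choose k : ℂ) ≠ 0 := Nat.cast_ne_zero.2 (Nat.choose_pos hk).ne'
        have := hz a
        have := hz k
        have := hz (n - k)
        field_simp
      have h4 : ∑ k ∈ range (n + 1), ((-1 : ℂ) ^ k * (n.choose k : ℂ)) =
          if n = 0 then 1 else 0 := by
        exact_mod_cast Int.alternating_sum_range_choose (n := n)
      rw [Finset.sum_congr rfl e, ← Finset.mul_sum, h4]
      by_cases hn : n = 0
      · subst hn
        simp [Nat.factorial_ne_zero]
      · simp [hn]
    · intro i hi
      rw [projCoeff_of_lt (mem_range.1 hi), zero_mul]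

variable (U) in
/-- For a lower set `D`, the operator with exponents in `D` that maps `x^α` to `x^β` and kills the
other monomials with exponents in `D`. -/
def elemOp (D : Finset (ℕ × ℕ)) (α β : ℕ × ℕ) : Op U :=
  ∑ γ ∈ D, (projCoeff α.1 γ.1 * projCoeff α.2 γ.2) •
    (mulOp (mon U (γ.1 - α.1 + β.1) (γ.2 - α.2 + β.2)) * dx U ^ γ.1 * dy U ^ γ.2)

theorem elemOp_mem {D : Finset (ℕ × ℕ)} {P : ℕ → ℕ → Prop} (h : ∀ γ ∈ D, P γ.1 γ.2)
    (α β : ℕ × ℕ) : elemOp U D α β ∈ diffOpOn U P :=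
  sum_mem fun γ hγ => Submodule.smul_mem _ _ (monomialOp_mem _ (h γ hγ))

theorem elemOp_mon (D : Finset (ℕ × ℕ)) (α β : ℕ × ℕ) (a b : ℕ) :
    elemOp U D α β (mon U a b) =
      (∑ γ ∈ D, (projCoeff α.1 γ.1 * (a.descFactorial γ.1 : ℂ)) *
        (projCoeff α.2 γ.2 * (b.descFactorial γ.2 : ℂ))) •
          mon U (a - α.1 + β.1) (b - α.2 + β.2) := by
  rw [elemOp, LinearMap.sum_apply, Finset.sum_smul]
  refine Finset.sum_congr rfl fun γ _ => ?_
  rw [LinearMap.smul_apply, monomialOp_mon, mon_mul, smul_smul]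
  by_cases h : α.1 ≤ γ.1 ∧ α.2 ≤ γ.2 ∧ γ.1 ≤ a ∧ γ.2 ≤ b
  · congr 1
    · ring
    · congr 1 <;> omega
  · have : projCoeff α.1 γ.1 = 0 ∨ projCoeff α.2 γ.2 = 0 ∨ a.descFactorial γ.1 = 0 ∨
        b.descFactorial γ.2 = 0 := by
      rw [Nat.descFactorial_eq_zero_iff_lt, Nat.descFactorial_eq_zero_iff_lt]
      by_cases h1 : α.1 ≤ γ.1
      · by_cases h2 : α.2 ≤ γ.2
        · right; right; omega
        · exact Or.inr (Or.inl (projCoeff_of_lt (by omega)))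
      · exact Or.inl (projCoeff_of_lt (by omega))
    rcases this with h | h | h | h <;> simp [h]

/-- A lower set containing `γ` contains the whole box below `γ`, and falling factorials vanish
outside that box. Over the box the sum is a product of two one-variable sums. -/
theorem elemOp_mon_of_mem {D : Finset (ℕ × ℕ)}
    (hD : ∀ i j i' j', (i, j) ∈ D → i' ≤ i → j' ≤ j → (i', j') ∈ D) (α β : ℕ × ℕ) {γ : ℕ × ℕ}
    (hγ : γ ∈ D) :
    elemOp U D α β (mon U γ.1 γ.2) = if γ = α then mon U β.1 β.2 else 0 := by
  have hs : range (γ.1 + 1) ×ˢ range (γ.2 + 1) ⊆ D := fun δ hδ => by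
    rw [mem_product, mem_range, mem_range] at hδ
    exact hD γ.1 γ.2 δ.1 δ.2 hγ (by omega) (by omega)
  rw [elemOp_mon, ← Finset.sum_subset hs, Finset.sum_product]
  · dsimp only
    simp_rw [← Finset.mul_sum]
    rw [← Finset.sum_mul, sum_projCoeff_mul_descFactorial, sum_projCoeff_mul_descFactorial]
    by_cases h : γ = α
    · subst h; simp
    · rw [if_neg h]
      by_cases h1 : γ.1 = α.1
      · rw [if_neg fun h2 => h (Prod.ext h1 h2)]; simp
      · rw [if_neg h1]; simp
  · intro δ _ hδ
    rw [mem_product, mem_range, mem_range] at hδ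
    by_cases h : γ.1 < δ.1
    · simp [Nat.descFactorial_of_lt h]
    · rw [Nat.descFactorial_of_lt (show γ.2 < δ.2 by omega)]; simp

theorem hasBidegree_elemOp (D : Finset (ℕ × ℕ)) (α β : ℕ × ℕ) :
    HasBidegree U (elemOp U D α β) ((β.1 : ℤ) - α.1) ((β.2 : ℤ) - α.2) := by
  intro a b
  change elemOp U D α β (mon U a b) ∈ _
  rw [elemOp_mon]
  by_cases h : α.1 ≤ a ∧ α.2 ≤ b
  · exact Submodule.smul_mem _ _ (Submodule.subset_span
      ⟨a - α.1 + β.1, b - α.2 + β.2, by omega, by omega, rfl⟩)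
  · rw [Finset.sum_eq_zero, zero_smul]
    · exact zero_mem _
    · intro γ _
      by_cases h1 : α.1 ≤ γ.1
      · by_cases h2 : α.2 ≤ γ.2
        · by_cases h3 : a < γ.1
          · simp [Nat.descFactorial_of_lt h3]
          · rw [Nat.descFactorial_of_lt (show b < γ.2 by omega)]; simp
        · simp [projCoeff_of_lt (not_le.1 h2)]
      · simp [projCoeff_of_lt (not_le.1 h1)]

/-! ### The staircase module, its distinguished complement and the downward part -/

/-- The exponents of the monomials that span the staircase module. -/
def stairPts (r p q : ℕ) : Finset (ℕ × ℕ) :=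
  (range (p + 1) ×ˢ range (q + 1)).filter fun α => α.1 + r * α.2 ≤ p

variable {r p q : ℕ}

theorem mem_stairPts {α : ℕ × ℕ} : α ∈ stairPts r p q ↔ α.1 + r * α.2 ≤ p ∧ α.2 ≤ q := by
  rw [stairPts, mem_filter, mem_product, mem_range, mem_range]
  omega

theorem stairPts_lower (i j i' j' : ℕ) (h : (i, j) ∈ stairPts r p q) (hi : i' ≤ i) (hj : j' ≤ j) :
    (i', j') ∈ stairPts r p q := by
  rw [mem_stairPts] at h ⊢
  have := Nat.mul_le_mul_left r hj
  dsimp only at *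
  omega

theorem stair_eq_span :
    stair U r p q = Submodule.span ℂ ((fun α : ℕ × ℕ => mon U α.1 α.2) '' stairPts r p q) := by
  rw [stair]
  congr 1
  ext g
  constructor
  · rintro ⟨i, j, h1, h2, rfl⟩
    exact ⟨(i, j), mem_coe.2 (mem_stairPts.2 ⟨h1, h2⟩), rfl⟩
  · rintro ⟨α, h, rfl⟩
    have := mem_stairPts.1 (mem_coe.1 h)
    exact ⟨α.1, α.2, this.1, this.2, rfl⟩

theorem mon_mem_stair {α : ℕ × ℕ} (h : α ∈ stairPts r p q) : mon U α.1 α.2 ∈ stair U r p q := by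
  rw [stair_eq_span]
  exact Submodule.subset_span ⟨α, mem_coe.2 h, rfl⟩

theorem map_stair_of_mon {T : Op U}
    (h : ∀ α ∈ stairPts r p q, T (mon U α.1 α.2) ∈ stair U r p q) :
    ∀ g ∈ stair U r p q, T g ∈ stair U r p q := by
  intro g hg
  rw [stair_eq_span] at hg
  induction hg using Submodule.span_induction with
  | mem g h' =>
    obtain ⟨α, hα, rfl⟩ := h'
    exact h α (mem_coe.1 hα)
  | zero => rw [map_zero]; exact zero_mem _
  | add f g _ _ hf hg => rw [map_add]; exact add_mem hf hg
  | smul c g _ hg => rw [map_smul]; exact Submodule.smul_mem _ c hg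

theorem mem_ker_restr {T : preserving U r p q} :
    T ∈ LinearMap.ker (restr U r p q) ↔
      ∀ α ∈ stairPts r p q, (T : Op U) (mon U α.1 α.2) = 0 := by
  rw [LinearMap.mem_ker]
  constructor
  · intro h α hα
    have := LinearMap.congr_fun h ⟨mon U α.1 α.2, mon_mem_stair hα⟩
    exact congrArg Subtype.val this
  · intro h
    refine LinearMap.ext fun ⟨g, hg⟩ => Subtype.ext ?_
    change (T : Op U) g = 0
    rw [stair_eq_span] at hg
    induction hg using Submodule.span_induction with
    | mem g h' =>
      obtain ⟨α, hα, rfl⟩ := h'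
      exact h α (mem_coe.1 hα)
    | zero => rw [map_zero]
    | add f g _ _ hf hg => rw [map_add, hf, hg, add_zero]
    | smul c g _ hg => rw [map_smul, hg, smul_zero]

theorem mem_distinguished {T : preserving U r p q} :
    T ∈ distinguished U r p q ↔ (T : Op U) ∈ diffOpOn U fun i j => i + r * j ≤ p ∧ j ≤ q := Iff.rfl

/-- The derivatives allowed in the distinguished space have the same exponents as the monomials of
the module, so vanishing on the module forces the operator to vanish. -/
theorem disjoint_distinguished :
    Disjoint (distinguished U r p q) (LinearMap.ker (restr U r p q)) := by
  rw [Submodule.disjoint_def]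
  intro T hT hk
  rw [mem_ker_restr] at hk
  refine Subtype.ext (eq_zero_of_mon (mem_distinguished.1 hT) fun a b h => ?_)
  exact hk (a, b) (mem_stairPts.2 h)

theorem elemOp_mem_preserving (α : ℕ × ℕ) {β : ℕ × ℕ} (hβ : β ∈ stairPts r p q) :
    elemOp U (stairPts r p q) α β ∈ preserving U r p q := by
  refine ⟨elemOp_mem (fun _ _ => trivial) α β, map_stair_of_mon fun γ hγ => ?_⟩
  rw [elemOp_mon_of_mem stairPts_lower α β hγ]
  split_ifs
  · exact mon_mem_stair hβ
  · exact zero_mem _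

variable (U) in
/-- The elementary operators of the staircase module. -/
def stairElem (r p q : ℕ) (α : ℕ × ℕ) (β : stairPts r p q) : preserving U r p q :=
  ⟨elemOp U (stairPts r p q) α β, elemOp_mem_preserving α β.2⟩

theorem stairElem_mem_distinguished (α : ℕ × ℕ) (β : stairPts r p q) :
    stairElem U r p q α β ∈ distinguished U r p q :=
  elemOp_mem (fun _ h => mem_stairPts.1 h) α β

theorem stairElem_mon (α : ℕ × ℕ) (β : stairPts r p q) {γ : ℕ × ℕ} (hγ : γ ∈ stairPts r p q) :
    (stairElem U r p q α β : Op U) (mon U γ.1 γ.2) =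
      if γ = α then mon U β.1.1 β.1.2 else 0 :=
  elemOp_mon_of_mem stairPts_lower α β hγ

/-- The operator with matrix `C` on the staircase module. -/
def stairMatrix (C : stairPts r p q → stairPts r p q → ℂ) : preserving U r p q :=
  ∑ α : stairPts r p q, ∑ β : stairPts r p q, C α β • stairElem U r p q α β

theorem stairMatrix_mem_distinguished (C : stairPts r p q → stairPts r p q → ℂ) :
    stairMatrix (U := U) C ∈ distinguished U r p q :=
  sum_mem fun _ _ => sum_mem fun _ _ =>
    Submodule.smul_mem _ _ (stairElem_mem_distinguished _ _)

theorem stairMatrix_mon (C : stairPts r p q → stairPts r p q → ℂ) (γ : stairPts r p q) :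
    (stairMatrix (U := U) C : Op U) (mon U γ.1.1 γ.1.2) =
      ∑ β : stairPts r p q, C γ β • mon U β.1.1 β.1.2 := by
  have e : (stairMatrix (U := U) C : Op U) =
      ∑ α : stairPts r p q, ∑ β : stairPts r p q, C α β • (stairElem U r p q α β : Op U) := by
    rw [← Submodule.subtype_apply, stairMatrix]
    simp only [map_sum, map_smul, Submodule.subtype_apply]
  rw [e, LinearMap.sum_apply, Finset.sum_eq_single γ]
  · rw [LinearMap.sum_apply]
    refine Finset.sum_congr rfl fun β _ => ?_
    rw [LinearMap.smul_apply, stairElem_mon _ _ γ.2, if_pos rfl]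
  · intro α _ hα
    rw [LinearMap.sum_apply]
    refine Finset.sum_eq_zero fun β _ => ?_
    rw [LinearMap.smul_apply, stairElem_mon _ _ γ.2, if_neg fun h => hα (Subtype.ext h.symm),
      smul_zero]
  · intro h; exact absurd (mem_univ _) h

theorem exists_stairMatrix (T : preserving U r p q) :
    ∃ C : stairPts r p q → stairPts r p q → ℂ,
      ∀ γ : stairPts r p q, (T : Op U) (mon U γ.1.1 γ.1.2) =
        ∑ β : stairPts r p q, C γ β • mon U β.1.1 β.1.2 := by
  have h (γ : stairPts r p q) : ∃ c : stairPts r p q → ℂ,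
      (T : Op U) (mon U γ.1.1 γ.1.2) = ∑ β : stairPts r p q, c β • mon U β.1.1 β.1.2 := by
    have := T.2.2 _ (mon_mem_stair (U := U) γ.2)
    rw [stair_eq_span, Set.image_eq_range, Submodule.mem_span_range_iff_exists_fun] at this
    obtain ⟨c, hc⟩ := this
    exact ⟨c, hc.symm⟩
  choose C hC using h
  exact ⟨C, hC⟩

theorem sub_stairMatrix_mem_ker {T : preserving U r p q}
    {C : stairPts r p q → stairPts r p q → ℂ}
    (hC : ∀ γ : stairPts r p q, (T : Op U) (mon U γ.1.1 γ.1.2) =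
        ∑ β : stairPts r p q, C γ β • mon U β.1.1 β.1.2) :
    T - stairMatrix C ∈ LinearMap.ker (restr U r p q) := by
  rw [mem_ker_restr]
  intro α hα
  rw [Submodule.coe_sub, LinearMap.sub_apply, hC ⟨α, hα⟩, stairMatrix_mon C ⟨α, hα⟩, sub_self]

/-- Every endomorphism of the module has a matrix, and the combination of elementary operators with
that matrix is a distinguished operator with the same restriction. -/
theorem isCompl_distinguished :
    IsCompl (distinguished U r p q) (LinearMap.ker (restr U r p q)) := by
  refine ⟨disjoint_distinguished, codisjoint_iff.2 (eq_top_iff.2 fun T _ => ?_)⟩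
  obtain ⟨C, hC⟩ := exists_stairMatrix T
  rw [← add_sub_cancel (stairMatrix C) T]
  exact Submodule.add_mem_sup (stairMatrix_mem_distinguished C) (sub_stairMatrix_mem_ker hC)

theorem projection_eq_of_sub_mem_ker
    (hc : IsCompl (distinguished U r p q) (LinearMap.ker (restr U r p q)))
    {S T : preserving U r p q} (hS : S ∈ distinguished U r p q)
    (h : T - S ∈ LinearMap.ker (restr U r p q)) : Submodule.projection _ _ hc T = S := by
  rw [← add_sub_cancel S T, map_add, (Submodule.projection_apply_eq_zero_iff hc).2 h, add_zero]
  exact Submodule.projection_apply_left hc ⟨S, hS⟩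

theorem exists_monRepr (hU : (U : Set (ℂ × ℂ)).Nonempty) :
    ∃ φ : Smooth U →ₗ[ℂ] (ℕ × ℕ →₀ ℂ), ∀ a b, φ (mon U a b) = Finsupp.single (a, b) 1 := by
  -- A left inverse extends the coefficient functionals arbitrarily to nonpolynomial functions; only
  -- the values on polynomials are used.
  obtain ⟨φ, hφ⟩ := LinearMap.exists_leftInverse_of_injective _
    (LinearMap.ker_eq_bot_of_injective (linearIndependent_mon hU))
  refine ⟨φ, fun a b => ?_⟩
  have := LinearMap.congr_fun hφ (Finsupp.single (a, b) 1)
  simpa using this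

/-- The coefficients of a function at the monomials, extended linearly from polynomials to all
smooth functions. -/
def monRepr (hU : (U : Set (ℂ × ℂ)).Nonempty) : Smooth U →ₗ[ℂ] (ℕ × ℕ →₀ ℂ) :=
  (exists_monRepr hU).choose

theorem monRepr_mon (hU : (U : Set (ℂ × ℂ)).Nonempty) (a b : ℕ) :
    monRepr hU (mon U a b) = Finsupp.single (a, b) 1 :=
  (exists_monRepr hU).choose_spec a b

theorem monRepr_sum (hU : (U : Set (ℂ × ℂ)).Nonempty) (c : stairPts r p q → ℂ)
    (β : stairPts r p q) :
    monRepr hU (∑ α : stairPts r p q, c α • mon U α.1.1 α.1.2) β.1 = c β := by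
  rw [map_sum, Finsupp.finsetSum_apply, Finset.sum_eq_single β]
  · rw [map_smul, monRepr_mon, Finsupp.smul_apply, Finsupp.single_eq_same, smul_eq_mul, mul_one]
  · intro α _ hα
    rw [map_smul, monRepr_mon, Finsupp.smul_apply,
      Finsupp.single_eq_of_ne (fun h => hα (Subtype.ext h.symm)), smul_zero]
  · intro h; exact absurd (mem_univ _) h

theorem monRepr_eq_zero_of_hasBidegree (hU : (U : Set (ℂ × ℂ)).Nonempty) {T : Op U} {i j : ℤ}
    (hT : HasBidegree U T i j) (a b : ℕ) {β : ℕ × ℕ}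
    (h : ¬((β.1 : ℤ) = a + i ∧ (β.2 : ℤ) = b + j)) :
    monRepr hU (T (mon U a b)) β = 0 := by
  have := hT a b
  change T (mon U a b) ∈ _ at this
  generalize T (mon U a b) = f at this
  induction this using Submodule.span_induction with
  | mem g hg =>
    obtain ⟨c, d, hc, hd, rfl⟩ := hg
    change monRepr hU (mon U c d) β = 0
    rw [monRepr_mon, Finsupp.single_eq_of_ne]
    rintro rfl
    exact h ⟨hc, hd⟩
  | zero => rw [map_zero]; rfl
  | add f g _ _ hf hg => rw [map_add, Finsupp.add_apply, hf, hg, add_zero]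
  | smul c g _ hg => rw [map_smul, Finsupp.smul_apply, hg, smul_zero]

variable (r p q) in
/-- The pairs `(α, β)` of exponents of the staircase module with `β₂ ≤ α₂`. -/
abbrev DownPairs : Type :=
  {x : stairPts r p q × stairPts r p q // x.2.1.2 ≤ x.1.1.2}

theorem linearIndependent_stairElem (hU : (U : Set (ℂ × ℂ)).Nonempty) :
    LinearIndependent ℂ fun x : stairPts r p q × stairPts r p q =>
      stairElem U r p q x.1 x.2 := by
  rw [Fintype.linearIndependent_iff]
  intro g hg x
  rw [Fintype.sum_prod_type] at hg
  have h := stairMatrix_mon (U := U) (fun α β => g (α, β)) x.1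
  rw [stairMatrix, hg] at h
  have h' := monRepr_sum hU (fun β => g (x.1, β)) x.2
  rw [← h] at h'
  rw [← h', ZeroMemClass.coe_zero, LinearMap.zero_apply, map_zero]
  rfl

theorem stairMatrix_mem_span {C : stairPts r p q → stairPts r p q → ℂ}
    (hC : ∀ α β, C α β ≠ 0 → β.1.2 ≤ α.1.2) :
    stairMatrix (U := U) C ∈ Submodule.span ℂ
      (Set.range fun x : DownPairs r p q => stairElem U r p q x.1.1 x.1.2) := by
  refine sum_mem fun α _ => sum_mem fun β _ => ?_
  by_cases h : C α β = 0
  · rw [h, zero_smul]; exact zero_mem _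
  · exact Submodule.smul_mem _ _ (Submodule.subset_span ⟨⟨(α, β), hC α β h⟩, rfl⟩)

theorem matrix_down_of_hasBidegree (hU : (U : Set (ℂ × ℂ)).Nonempty) {T : preserving U r p q}
    {C : stairPts r p q → stairPts r p q → ℂ}
    (hC : ∀ γ : stairPts r p q, (T : Op U) (mon U γ.1.1 γ.1.2) =
        ∑ β : stairPts r p q, C γ β • mon U β.1.1 β.1.2) {i j : ℤ} (hj : j ≤ 0)
    (hT : HasBidegree U (T : Op U) i j) (α β : stairPts r p q) (h : C α β ≠ 0) :
    β.1.2 ≤ α.1.2 := by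
  by_contra h'
  refine h ?_
  rw [← monRepr_sum hU (C α) β, ← hC]
  refine monRepr_eq_zero_of_hasBidegree hU hT _ _ ?_
  rintro ⟨-, h2⟩
  omega

/-- A bidegree with nonpositive `y`-degree only allows matrix entries that do not raise the
`y`-exponent. Conversely, the matrix units are themselves homogeneous, of bidegree `β - α`. -/
theorem distinguishedDown_eq_span (hU : (U : Set (ℂ × ℂ)).Nonempty) :
    distinguishedDown U r p q = Submodule.span ℂ
      (Set.range fun x : DownPairs r p q => stairElem U r p q x.1.1 x.1.2) := by
  refine le_antisymm (Submodule.span_le.2 ?_) (Submodule.span_le.2 ?_)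
  · rintro T ⟨hT, i, j, hj, hb⟩
    obtain ⟨C, hC⟩ := exists_stairMatrix T
    have : T = stairMatrix C := by
      rw [← sub_eq_zero]
      exact Submodule.disjoint_def.1 disjoint_distinguished _
        (sub_mem hT (stairMatrix_mem_distinguished C)) (sub_stairMatrix_mem_ker hC)
    rw [this]
    exact stairMatrix_mem_span (matrix_down_of_hasBidegree hU hC hj hb)
  · rintro _ ⟨x, rfl⟩
    refine Submodule.subset_span ⟨stairElem_mem_distinguished _ _, _, _, ?_,
      hasBidegree_elemOp _ _ _⟩
    have := x.2
    omega

theorem projection_mem_distinguishedDown (hU : (U : Set (ℂ × ℂ)).Nonempty)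
    (hc : IsCompl (distinguished U r p q) (LinearMap.ker (restr U r p q)))
    (T : preserving U r p q) {i j : ℤ} (hj : j ≤ 0) (hT : HasBidegree U (T : Op U) i j) :
    Submodule.projection _ _ hc T ∈ distinguishedDown U r p q := by
  obtain ⟨C, hC⟩ := exists_stairMatrix T
  rw [projection_eq_of_sub_mem_ker hc (stairMatrix_mem_distinguished C)
    (sub_stairMatrix_mem_ker hC), distinguishedDown_eq_span hU]
  exact stairMatrix_mem_span (matrix_down_of_hasBidegree hU hC hj hT)

theorem finiteDimensional_distinguishedDown (hU : (U : Set (ℂ × ℂ)).Nonempty) :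
    FiniteDimensional ℂ (distinguishedDown U r p q) := by
  rw [distinguishedDown_eq_span hU]
  exact FiniteDimensional.span_of_finite ℂ (Set.finite_range _)

theorem finrank_distinguishedDown (hU : (U : Set (ℂ × ℂ)).Nonempty) :
    Module.finrank ℂ (distinguishedDown U r p q) = Fintype.card (DownPairs r p q) := by
  rw [distinguishedDown_eq_span hU]
  exact finrank_span_eq_card ((linearIndependent_stairElem hU).comp _ Subtype.val_injective)

/-! ### The dimension count -/

/-- With `P = p + 1`, the row of the staircase at height `b` has `P - r b` points; this sums the
products of row lengths over pairs of heights `d ≤ b ≤ q`. -/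
theorem sum_mul_sum_eq (r P : ℚ) (q : ℕ) :
    ∑ b ∈ range (q + 1), (P - r * b) * ∑ d ∈ range (b + 1), (P - r * d) =
      ((q : ℚ) + 1) * (q + 2) / 2 * (P * (P - q * r) + (q : ℚ) * r ^ 2 / 12 * (3 * q + 1)) := by
  have h (b : ℕ) : ∑ d ∈ range (b + 1), (P - r * (d : ℚ)) =
      (b + 1) * P - r * (b * (b + 1)) / 2 := by
    induction b with
    | zero => simp
    | succ b ih => rw [Finset.sum_range_succ, ih]; push_cast; ring
  induction q with
  | zero => simp
  | succ q ih => rw [Finset.sum_range_succ, ih, h]; push_cast; ring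

theorem card_downPairs (h : q * r ≤ p) :
    (Fintype.card (DownPairs r p q) : ℚ) = ((q : ℚ) + 1) * (q + 2) / 2 *
      (((p : ℚ) + 1) * (p + 1 - q * r) + (q : ℚ) * r ^ 2 / 12 * (3 * q + 1)) := by
  let K : Finset (Σ _ : (Σ _ : ℕ, ℕ), ℕ × ℕ) :=
    ((range (q + 1)).sigma fun b => range (b + 1)).sigma fun x =>
      range (p + 1 - r * x.1) ×ˢ range (p + 1 - r * x.2)
  have hK : Fintype.card (DownPairs r p q) = K.card := by
    rw [← Finset.card_univ]
    refine Finset.card_bij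
      (fun x _ => ⟨⟨x.1.1.1.2, x.1.2.1.2⟩, (x.1.1.1.1, x.1.2.1.1)⟩) ?_ ?_ ?_
    · rintro ⟨⟨⟨⟨a, b⟩, h1⟩, ⟨⟨c, d⟩, h2⟩⟩, h3⟩ -
      rw [mem_stairPts] at h1 h2
      dsimp only at h1 h2 h3
      simp only [K, mem_sigma, mem_range, mem_product]
      omega
    · rintro ⟨⟨⟨⟨a, b⟩, h1⟩, ⟨⟨c, d⟩, h2⟩⟩, h3⟩ - ⟨⟨⟨⟨a', b'⟩, h1'⟩, ⟨⟨c', d'⟩, h2'⟩⟩, h3'⟩ - he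
      simp only [Sigma.mk.injEq, heq_eq_eq, Prod.mk.injEq] at he
      simp [he]
    · rintro ⟨⟨b, d⟩, ⟨a, c⟩⟩ hx
      simp only [K, mem_sigma, mem_range, mem_product] at hx
      have hd : r * d ≤ r * b := Nat.mul_le_mul_left r (by omega)
      exact ⟨⟨(⟨(a, b), mem_stairPts.2 (by dsimp only; omega)⟩,
        ⟨(c, d), mem_stairPts.2 (by dsimp only; omega)⟩), by dsimp only; omega⟩, mem_univ _, rfl⟩
  rw [hK, Finset.card_sigma, Finset.sum_sigma]
  push_cast [Finset.card_product, Finset.card_range]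
  rw [← sum_mul_sum_eq]
  refine Finset.sum_congr rfl fun b hb => ?_
  rw [Finset.mul_sum]
  refine Finset.sum_congr rfl fun d hd => ?_
  -- The hypothesis `q r ≤ p` keeps every row nonempty, so the truncated subtractions are true ones.
  have hb' : r * b ≤ p := (Nat.mul_le_mul_left r (by have := mem_range.1 hb; omega)).trans
    ((mul_comm r q).le.trans h)
  have hd' : r * d ≤ r * b := Nat.mul_le_mul_left r (by have := mem_range.1 hd; omega)
  rw [Nat.cast_sub (by omega), Nat.cast_sub (by omega)]
  push_cast
  ring

/-! ### Polynomial interpolation on lower sets -/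

section Interpolation

open Polynomial

/-- On the bottom line `y = v` the polynomial has some degree `n` in `x`, and the lower set supplies
the `n + 1` roots `u, …, u + n`. So `y - v` divides `f`, and the quotient satisfies the same
hypotheses for the lower set with its bottom row removed and `v` replaced by `v + 1`. The bound `M`
on the height drives the induction. -/
theorem bivariate_eq_zero (P : ℕ → ℕ → Prop)
    (hP : ∀ i j i' j', P i j → i' ≤ i → j' ≤ j → P i' j') (M : ℕ) (hM : ∀ i j, P i j → j < M)
    (u v : ℂ) (f : ℂ[X][X]) (hf : ∀ i j, (f.coeff i).coeff j ≠ 0 → P i j)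
    (h0 : ∀ a b, P a b → (f.map (evalRingHom (v + b))).eval (u + a) = 0) : f = 0 := by
  induction M generalizing P v f with
  | zero =>
    ext i j
    by_contra h
    exact absurd (hM i j (hf i j h)) (Nat.not_lt_zero j)
  | succ M ih =>
    have hg : f.map (evalRingHom v) = 0 := by
      set g := f.map (evalRingHom v) with hgdef
      by_contra hne
      have hd : f.coeff g.natDegree ≠ 0 := by
        intro h
        refine hne (leadingCoeff_eq_zero.1 ?_)
        rw [leadingCoeff, hgdef, coeff_map, ← hgdef, h, map_zero]
      have hPd : P g.natDegree 0 :=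
        hP _ _ _ _ (hf g.natDegree _ (leadingCoeff_ne_zero.2 hd)) le_rfl (Nat.zero_le _)
      refine hne (eq_zero_of_natDegree_lt_card_of_eval_eq_zero g
        (f := fun i : Fin (g.natDegree + 1) => u + ((i : ℕ) : ℂ)) ?_ (fun i => ?_) (by simp))
      · intro i j hij
        have : ((i : ℕ) : ℂ) = (j : ℕ) := add_left_cancel hij
        exact Fin.ext (Nat.cast_injective this)
      · have := h0 i 0 (hP _ _ _ _ hPd (Nat.lt_succ_iff.1 i.2) le_rfl)
        simpa using this
    obtain ⟨f', rfl⟩ : C (Polynomial.X - C v) ∣ f := by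
      rw [C_dvd_iff_dvd_coeff]
      intro i
      rw [dvd_iff_isRoot, IsRoot]
      have := congrArg (fun g => g.coeff i) hg
      simpa using this
    suffices f' = 0 by rw [this, mul_zero]
    refine ih (fun i j => P i (j + 1)) (fun i j i' j' h hi hj => hP _ _ _ _ h hi (by omega))
      (fun i j h => by have := hM _ _ h; omega) (v + 1) f' (fun i j h => ?_) fun a b h => ?_
    · have hne : f'.coeff i ≠ 0 := fun h' => h (by rw [h', coeff_zero])
      have hdeg : ((Polynomial.X - C v) * f'.coeff i).natDegree = (f'.coeff i).natDegree + 1 := by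
        rw [natDegree_mul (X_sub_C_ne_zero v) hne, natDegree_X_sub_C, add_comm]
      have hlead : ((Polynomial.X - C v) * f'.coeff i).coeff ((f'.coeff i).natDegree + 1) ≠ 0 := by
        rw [← hdeg]
        exact leadingCoeff_ne_zero.2 (mul_ne_zero (X_sub_C_ne_zero v) hne)
      refine hP i ((f'.coeff i).natDegree + 1) _ _ (hf _ _ ?_) le_rfl
        (by have := le_natDegree_of_ne_zero h; omega)
      rwa [coeff_C_mul]
    · have := h0 a (b + 1) h
      rw [Polynomial.map_mul, eval_mul, Polynomial.map_C, eval_C, mul_eq_zero] at this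
      rcases this with h' | h'
      · exfalso
        have h'' : ((b + 1 : ℕ) : ℂ) = 0 := by simpa using h'
        exact absurd (Nat.cast_eq_zero.1 h'') (Nat.succ_ne_zero b)
      · rw [show v + 1 + (b : ℂ) = v + ((b + 1 : ℕ) : ℂ) by push_cast; ring]
        exact h'

/-- A polynomial with exponents in a finite lower set `D` that vanishes at the points of a translate
of `D` is zero. -/
theorem eq_zero_of_sum_eq_zero (D : Finset (ℕ × ℕ))
    (hD : ∀ i j i' j', (i, j) ∈ D → i' ≤ i → j' ≤ j → (i', j') ∈ D) (u v : ℂ) (c : ℕ × ℕ → ℂ)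
    (h : ∀ x ∈ D, ∑ y ∈ D, c y * ((u + x.1) ^ y.1 * (v + x.2) ^ y.2) = 0) {y : ℕ × ℕ}
    (hy : y ∈ D) : c y = 0 := by
  classical
  set f : ℂ[X][X] := ∑ y ∈ D, monomial y.1 (monomial y.2 (c y)) with hf
  have hc (i j : ℕ) : (f.coeff i).coeff j = if (i, j) ∈ D then c (i, j) else 0 := by
    rw [hf, finsetSum_coeff, finsetSum_coeff]
    by_cases hij : (i, j) ∈ D
    · rw [if_pos hij, Finset.sum_eq_single (i, j)]
      · simp
      · intro z _ hz
        rw [coeff_monomial]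
        split_ifs with h1
        · rw [coeff_monomial, if_neg fun h2 => hz (Prod.ext h1 h2)]
        · simp
      · intro h; exact absurd hij h
    · rw [if_neg hij]
      refine Finset.sum_eq_zero fun z hz => ?_
      rw [coeff_monomial]
      split_ifs with h1
      · rw [coeff_monomial, if_neg]
        rintro rfl
        subst h1
        exact hij hz
      · simp
  have : f = 0 := by
    refine bivariate_eq_zero (fun i j => (i, j) ∈ D) hD (D.sup Prod.snd + 1)
      (fun i j hij => Nat.lt_succ_of_le (Finset.le_sup (f := Prod.snd) hij)) u v f
      (fun i j hij => ?_) fun a b hab => ?_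
    · by_contra h'
      exact hij (by rw [hc, if_neg h'])
    · rw [← h (a, b) hab, hf, Polynomial.map_sum, eval_finsetSum]
      refine Finset.sum_congr rfl fun y _ => ?_
      rw [map_monomial, eval_monomial, coe_evalRingHom, eval_monomial]
      ring
  have h' := hc y.1 y.2
  rw [this, if_pos hy] at h'
  simpa using h'.symm

/-- The interpolation system is square, with unknowns and equations both indexed by `D`, so
uniqueness gives existence. -/
theorem exists_interpolation (D : Finset (ℕ × ℕ))
    (hD : ∀ i j i' j', (i, j) ∈ D → i' ≤ i → j' ≤ j → (i', j') ∈ D) (u v : ℂ) (h : ℕ × ℕ → ℂ) :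
    ∃ c : ℕ × ℕ → ℂ, ∀ x ∈ D, ∑ y ∈ D, c y * ((u + x.1) ^ y.1 * (v + x.2) ^ y.2) = h x := by
  classical
  let L : (D → ℂ) →ₗ[ℂ] (D → ℂ) :=
    LinearMap.pi fun x => ∑ y : D,
      ((u + x.1.1) ^ y.1.1 * (v + x.1.2) ^ y.1.2) • LinearMap.proj y
  have hL (c : D → ℂ) (x : D) :
      L c x = ∑ y : D, c y * ((u + x.1.1) ^ y.1.1 * (v + x.1.2) ^ y.1.2) := by
    simp [L, LinearMap.pi_apply, mul_comm]
  have hinj : Function.Injective L := by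
    rw [← LinearMap.ker_eq_bot, LinearMap.ker_eq_bot']
    intro c hc
    funext y
    have := eq_zero_of_sum_eq_zero D hD u v (fun z => if hz : z ∈ D then c ⟨z, hz⟩ else 0)
      (fun x hx => ?_) y.2
    · simpa using this
    · have h1 := congrFun hc ⟨x, hx⟩
      rw [hL] at h1
      rw [← Finset.sum_coe_sort]
      simpa using h1
  obtain ⟨c, hc⟩ := LinearMap.injective_iff_surjective.1 hinj fun x => h x.1
  refine ⟨fun z => if hz : z ∈ D then c ⟨z, hz⟩ else 0, fun x hx => ?_⟩
  have h1 := congrFun hc ⟨x, hx⟩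
  rw [hL] at h1
  rw [← Finset.sum_coe_sort]
  simpa using h1

end Interpolation

/-! ### Homogeneous operators and their weights -/

/-- `T` maps `x^a y^b` to `c(a, b) x^{a+d} y^{b+e}`, with `c(a, b) = 0` where an exponent on the
right is negative. -/
def IsHom (T : Op U) (d e : ℤ) (c : ℂ → ℂ → ℂ) : Prop :=
  ∀ a b : ℕ, (c a b ≠ 0 → 0 ≤ a + d ∧ 0 ≤ b + e) ∧
    T (mon U a b) = c a b • mon U (a + d).toNat (b + e).toNat

theorem IsHom.congr {T : Op U} {d d' e e' : ℤ} {c c' : ℂ → ℂ → ℂ} (h : IsHom T d e c)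
    (hd : d = d') (he : e = e') (hc : ∀ a b, c a b = c' a b) : IsHom T d' e' c' := by
  subst hd he
  have : c = c' := funext fun a => funext fun b => hc a b
  rwa [← this]

/-- Where an intermediate exponent would be negative the first weight is zero, so truncation by
`toNat` does no harm. -/
theorem IsHom.mul {S T : Op U} {d₁ e₁ d₂ e₂ : ℤ} {c₁ c₂ : ℂ → ℂ → ℂ} (hS : IsHom S d₁ e₁ c₁)
    (hT : IsHom T d₂ e₂ c₂) :
    IsHom (S * T) (d₂ + d₁) (e₂ + e₁) fun a b => c₂ a b * c₁ (a + d₂) (b + e₂) := by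
  intro a b
  rw [Module.End.mul_apply, (hT a b).2, map_smul]
  by_cases h : c₂ a b = 0
  · simp [h]
  · obtain ⟨h1, h2⟩ := (hT a b).1 h
    have e1 : (((a + d₂).toNat : ℕ) : ℂ) = a + d₂ := by
      rw [← Int.cast_natCast, Int.toNat_of_nonneg h1]; push_cast; rfl
    have e2 : (((b + e₂).toNat : ℕ) : ℂ) = b + e₂ := by
      rw [← Int.cast_natCast, Int.toNat_of_nonneg h2]; push_cast; rfl
    obtain ⟨h3, h4⟩ := hS (a + d₂).toNat (b + e₂).toNat
    rw [e1, e2] at h3 h4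
    rw [h4, smul_smul]
    refine ⟨fun h5 => ?_, ?_⟩
    · have := h3 (right_ne_zero_of_mul h5)
      omega
    · congr 2 <;> omega

theorem IsHom.one : IsHom (1 : Op U) 0 0 fun _ _ => 1 := fun a b => by simp

theorem IsHom.hasBidegree {T : Op U} {d e : ℤ} {c : ℂ → ℂ → ℂ} (h : IsHom T d e c) :
    HasBidegree U T d e := by
  intro a b
  change T (mon U a b) ∈ _
  obtain ⟨h1, h2⟩ := h a b
  rw [h2]
  by_cases h3 : c a b = 0
  · rw [h3, zero_smul]; exact zero_mem _
  · obtain ⟨h4, h5⟩ := h1 h3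
    exact Submodule.smul_mem _ _ (Submodule.subset_span
      ⟨_, _, Int.toNat_of_nonneg h4, Int.toNat_of_nonneg h5, rfl⟩)

theorem IsHom.pow_of_degree_zero {T : Op U} {c : ℂ → ℂ → ℂ} (h : IsHom T 0 0 c) (n : ℕ) :
    IsHom (T ^ n) 0 0 fun a b => c a b ^ n := by
  induction n with
  | zero => exact IsHom.one.congr rfl rfl fun a b => by simp
  | succ n ih =>
    rw [pow_succ']
    exact (h.mul ih).congr rfl rfl fun a b => by simp [pow_succ]

theorem isHom_dx : IsHom (dx U) (-1) 0 fun a _ => a := by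
  intro a b
  refine ⟨fun h => ?_, ?_⟩
  · have : a ≠ 0 := fun h' => h (by simp [h'])
    omega
  · rw [dx_mon]
    congr 2
    omega

theorem isHom_dy : IsHom (dy U) 0 (-1) fun _ b => b := by
  intro a b
  refine ⟨fun h => ?_, ?_⟩
  · have : b ≠ 0 := fun h' => h (by simp [h'])
    omega
  · rw [dy_mon]
    congr 2
    omega

theorem isHom_mulOp_mon (i j : ℕ) : IsHom (mulOp (mon U i j)) i j fun _ _ => 1 := by
  intro a b
  refine ⟨fun _ => by omega, ?_⟩
  rw [mulOp_mon, one_smul]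
  congr 1 <;> omega

theorem X_pow_eq_mon (i : ℕ) : X U ^ i = mon U i 0 := by simp [mon]

theorem isHom_dx_pow (s : ℕ) :
    IsHom (dx U ^ s) (-s) 0 fun a _ => ∏ h ∈ range s, (a - (h : ℂ)) := by
  induction s with
  | zero => exact IsHom.one.congr (by simp) rfl fun a b => by simp
  | succ s ih =>
    rw [pow_succ']
    exact (isHom_dx.mul ih).congr (by push_cast; ring) rfl fun a b => by
      rw [Finset.prod_range_succ]; push_cast; ring

theorem isHom_dy_pow (s : ℕ) :
    IsHom (dy U ^ s) 0 (-s) fun _ b => ∏ h ∈ range s, (b - (h : ℂ)) := by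
  induction s with
  | zero => exact IsHom.one.congr rfl (by simp) fun a b => by simp
  | succ s ih =>
    rw [pow_succ']
    exact (isHom_dy.mul ih).congr rfl (by push_cast; ring) fun a b => by
      rw [Finset.prod_range_succ]; push_cast; ring

theorem J_two : J U r p 2 = mulOp (X U ^ 2) * dx U + (r : ℂ) • (mulOp (X U * Y U) * dy U) -
    (p : ℂ) • mulOp (X U) := rfl

theorem J_three : J U r p 3 = mulOp (X U) * dx U - ((p : ℂ) / 2) • 1 := rfl

theorem J_four : J U r p 4 = mulOp (Y U) * dy U := rfl

theorem J_add_five (i : ℕ) : J U r p (i + 5) = mulOp (X U ^ i) * dy U := rfl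

theorem J_five : J U r p 5 = dy U := by
  rw [show (5 : ℕ) = 0 + 5 from rfl, J_add_five, pow_zero, mulOp_one, one_mul]

theorem isHom_J_one : IsHom (J U r p 1) (-1) 0 fun a _ => a := isHom_dx

theorem isHom_J_two : IsHom (J U r p 2) 1 0 fun a b => a + r * b - p := by
  intro a b
  refine ⟨fun _ => by omega, ?_⟩
  have e1 := ((isHom_mulOp_mon (U := U) 2 0).mul isHom_dx) a b
  have e2 := ((isHom_mulOp_mon (U := U) 1 1).mul isHom_dy) a b
  have e3 := (isHom_mulOp_mon (U := U) 1 0) a b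
  have h1 : X U ^ 2 = mon U 2 0 := X_pow_eq_mon 2
  have h2 : X U * Y U = mon U 1 1 := by simp [mon]
  have h3 : X U = mon U 1 0 := by simp [mon]
  rw [J_two, h1, h2, h3, LinearMap.sub_apply, LinearMap.add_apply, LinearMap.smul_apply,
    LinearMap.smul_apply, e1.2, e2.2, e3.2]
  simp only [mul_one, one_smul, Nat.cast_one, Nat.cast_zero, Nat.cast_ofNat, Int.reduceNeg,
    Int.reduceAdd, zero_add, neg_add_cancel, smul_smul]
  rw [sub_smul, add_smul]

theorem isHom_J_three : IsHom (J U r p 3) 0 0 fun a _ => a - p / 2 := by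
  intro a b
  refine ⟨fun _ => by omega, ?_⟩
  have e1 := ((isHom_mulOp_mon (U := U) 1 0).mul isHom_dx) a b
  have h3 : X U = mon U 1 0 := by simp [mon]
  rw [J_three, h3, LinearMap.sub_apply, LinearMap.smul_apply, e1.2, sub_smul]
  simp

theorem isHom_J_four : IsHom (J U r p 4) 0 0 fun _ b => b := by
  have h3 : Y U = mon U 0 1 := by simp [mon]
  rw [J_four, h3]
  exact ((isHom_mulOp_mon 0 1).mul isHom_dy).congr rfl rfl fun a b => mul_one b

theorem isHom_J_add_five (i : ℕ) : IsHom (J U r p (i + 5)) i (-1) fun _ b => b := by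
  rw [J_add_five, X_pow_eq_mon]
  exact ((isHom_mulOp_mon i 0).mul isHom_dy).congr (by simp) (by simp) fun a b => mul_one b

theorem isHom_J_two_pow (t : ℕ) :
    IsHom (J U r p 2 ^ t) t 0 fun a b => ∏ h ∈ range t, (a + r * b - p + (h : ℂ)) := by
  induction t with
  | zero => exact IsHom.one.congr (by simp) rfl fun a b => by simp
  | succ s ih =>
    rw [pow_succ']
    exact (isHom_J_two.mul ih).congr (by push_cast; ring) rfl fun a b => by
      rw [Finset.prod_range_succ]; push_cast; ring

/-! ### One normal form for both families of monomials -/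

/-- The number of factors `J^1` in the leading factor of `x`-degree `d`. -/
def lowering (d : ℤ) : ℕ := (-d).toNat

/-- The number of factors `J^2` in the leading factor of bidegree `(d, -j)`. -/
def raising (r : ℕ) (d : ℤ) (j : ℕ) : ℕ := (d - (r * j : ℕ)).toNat

variable (U) in
/-- The leading factor of the monomials of bidegree `(d, -j)`. -/
def lead (r p : ℕ) (d : ℤ) (j : ℕ) : Op U :=
  dx U ^ lowering d * J U r p 2 ^ raising r d j *
    (mulOp (X U ^ (min (max d 0) (r * j : ℕ)).toNat) * dy U ^ j)

/-- The eigenvalue of `lead` on `x^a y^b`. -/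
def leadCoeff (r p : ℕ) (d : ℤ) (j : ℕ) (a b : ℂ) : ℂ :=
  (∏ h ∈ range j, (b - (h : ℂ))) * (∏ h ∈ range (raising r d j), (a + r * b - p + (h : ℂ))) *
    ∏ h ∈ range (lowering d), (a - (h : ℂ))

theorem isHom_lead (d : ℤ) (j : ℕ) : IsHom (lead U r p d j) d (-j) (leadCoeff r p d j) := by
  rw [lead, X_pow_eq_mon]
  refine (((isHom_dx_pow _).mul (isHom_J_two_pow _)).mul
    ((isHom_mulOp_mon _ 0).mul (isHom_dy_pow j))).congr ?_ (by simp) fun a b => ?_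
  · simp only [lowering, raising]; omega
  · rw [leadCoeff, mul_one, mul_assoc]
    congr 1
    congr 1
    -- A factor `J^2` occurs only when the power of `x` is exactly `r j`. The shift by `(r j, -j)`
    -- preserves `a + r b`, so the weights of `J^2` can be written at the original point.
    · rcases Nat.eq_zero_or_pos (raising r d j) with h | h
      · rw [h]; simp
      · have : (min (max d 0) (r * j : ℕ)).toNat = r * j := by
          simp only [raising] at h; omega
        refine Finset.prod_congr rfl fun h _ => ?_
        rw [this]; push_cast; ring
    -- A factor `J^1` occurs only for `d < 0`; then nothing applied before it changes the
    -- `x`-exponent.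
    · rcases Nat.eq_zero_or_pos (lowering d) with h | h
      · rw [h]; simp
      · have h1 : (min (max d 0) (r * j : ℕ)).toNat = 0 := by
          simp only [lowering] at h; omega
        have h2 : raising r d j = 0 := by
          simp only [lowering, raising] at h ⊢; omega
        refine Finset.prod_congr rfl fun h _ => ?_
        rw [h1, h2]; simp

variable (U) in
/-- The monomials of both families, indexed by bidegree and by the exponents of `J^3`, `J^4`. -/
def basisMonomial (r p : ℕ) (d : ℤ) (j n m : ℕ) : Op U :=
  lead U r p d j * J U r p 3 ^ n * J U r p 4 ^ m

theorem isHom_basisMonomial (d : ℤ) (j n m : ℕ) :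
    IsHom (basisMonomial U r p d j n m) d (-j)
      fun a b => leadCoeff r p d j a b * ((a - p / 2) ^ n * b ^ m) := by
  refine (((isHom_lead d j).mul (isHom_J_three.pow_of_degree_zero n)).mul
    (isHom_J_four.pow_of_degree_zero m)).congr (by simp) (by simp) fun a b => ?_
  simp only [Int.cast_zero, add_zero]
  ring

theorem commute_mulOp_X_pow_dy (i : ℕ) : Commute (mulOp (X U ^ i)) (dy U) := by
  have h : partialD U (0, 1) (X U ^ i) = 0 := by
    rw [partialD_pow, partialD_X]; simp
  have := partialD_mul_mulOp (0, 1) (X U ^ i)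
  rw [h, mulOp_zero, zero_add] at this
  exact this.symm

theorem J_add_five_pow (i j : ℕ) :
    J U r p (i + 5) ^ j = mulOp (X U ^ (i * j)) * dy U ^ j := by
  rw [J_add_five, (commute_mulOp_X_pow_dy i).mul_pow, ← mulOp_pow, ← pow_mul]

theorem lead_of_nonpos (s j : ℕ) : lead U r p (-s) j = J U r p 1 ^ s * J U r p 5 ^ j := by
  have h1 : lowering (-s) = s := by simp [lowering]
  have h2 : raising r (-s) j = 0 := by simp only [raising]; omega
  have h3 : (min (max (-(s : ℤ)) 0) (r * j : ℕ)).toNat = 0 := by omega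
  rw [lead, h1, h2, h3, J_five, pow_zero, pow_zero, mul_one, mulOp_one, one_mul]
  rfl

theorem lead_of_ge (s j : ℕ) :
    lead U r p ((r * j : ℕ) + s) j = J U r p 2 ^ s * J U r p (r + 5) ^ j := by
  have h1 : lowering ((r * j : ℕ) + s) = 0 := by simp only [lowering]; omega
  have h2 : raising r ((r * j : ℕ) + s) j = s := by simp only [raising]; omega
  have h3 : (min (max (((r * j : ℕ) : ℤ) + s) 0) (r * j : ℕ)).toNat = r * j := by omega
  rw [lead, h1, h2, h3, J_add_five_pow, pow_zero, one_mul]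

theorem lead_of_le {d j : ℕ} (h : d ≤ r * j) :
    lead U r p d j = mulOp (X U ^ d) * dy U ^ j := by
  have h1 : lowering d = 0 := by simp only [lowering]; omega
  have h2 : raising r d j = 0 := by simp only [raising]; omega
  have h3 : (min (max (d : ℤ) 0) (r * j : ℕ)).toNat = d := by omega
  rw [lead, h1, h2, h3, pow_zero, pow_zero, one_mul, one_mul]

theorem J_five_mul_mul (t i u : ℕ) :
    J U r p 5 ^ t * J U r p (i + 5) * J U r p (r + 5) ^ u =
      mulOp (X U ^ (i + r * u)) * dy U ^ (t + u + 1) := by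
  have h1 := ((commute_mulOp_X_pow_dy (U := U) i).pow_right t).eq
  have h2 := ((commute_mulOp_X_pow_dy (U := U) (r * u)).pow_right (t + 1)).eq
  rw [J_five, J_add_five_pow, J_add_five]
  calc dy U ^ t * (mulOp (X U ^ i) * dy U) * (mulOp (X U ^ (r * u)) * dy U ^ u)
      = dy U ^ t * mulOp (X U ^ i) * (dy U * mulOp (X U ^ (r * u)) * dy U ^ u) := by
        simp only [mul_assoc]
    _ = mulOp (X U ^ i) * (dy U ^ (t + 1) * mulOp (X U ^ (r * u))) * dy U ^ u := by
        rw [← h1, pow_succ]; simp only [mul_assoc]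
    _ = mulOp (X U ^ (i + r * u)) * dy U ^ (t + u + 1) := by
        rw [← h2, pow_add (X U), ← mulOp_mul_mulOp, show t + u + 1 = t + 1 + u by omega,
          pow_add (dy U) (t + 1) u]
        simp only [mul_assoc]

theorem lead_of_extreme {ε : ℕ} (hε : ε ≤ 1) (s j : ℕ) :
    ∃ d : ℤ, lowering d + raising r d j = s ∧
      J U r p (ε + 1) ^ s * J U r p (ε * r + 5) ^ j = lead U r p d j := by
  have : ε = 0 ∨ ε = 1 := by omega
  rcases this with rfl | rfl
  · refine ⟨-s, ?_, ?_⟩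
    · simp only [lowering, raising]; omega
    · rw [lead_of_nonpos, zero_mul]
  · refine ⟨(r * j : ℕ) + s, ?_, ?_⟩
    · simp only [lowering, raising]; omega
    · rw [lead_of_ge, one_mul]

theorem lead_of_middle {t i j : ℕ} (ht : t + 1 ≤ j) (hi : i ≤ r) :
    ∃ d : ℤ, lowering d + raising r d j = 0 ∧
      J U r p 5 ^ t * J U r p (i + 5) * J U r p (r + 5) ^ (j - t - 1) = lead U r p d j := by
  obtain ⟨u, rfl⟩ := Nat.exists_eq_add_of_le ht
  have hle : i + r * u ≤ r * (t + 1 + u) := by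
    rw [mul_add, mul_add]; nlinarith [Nat.zero_le (r * t)]
  refine ⟨(i + r * u : ℕ), ?_, ?_⟩
  · simp only [lowering, raising]; omega
  · rw [lead_of_le hle, show t + 1 + u - t - 1 = u by omega, J_five_mul_mul]
    congr 2
    omega

/-- The values `d ≤ 0` and `d ≥ r j` are the two cases `ε = 0, 1`. In between, `lead` is `x^d ∂_y^j`
and is split by writing `d = i + r u` with `1 ≤ i ≤ r`. For `t = 0` one has `u = j - 1`, and
excluding `i = r` excludes `d = r j`, which is already covered. -/
theorem lead_cases (hr : 0 < r) (d : ℤ) (j : ℕ) :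
    (∃ ε ≤ 1, lead U r p d j =
      J U r p (ε + 1) ^ (lowering d + raising r d j) * J U r p (ε * r + 5) ^ j) ∨
    (lowering d + raising r d j = 0 ∧ ∃ t i, t + 1 ≤ j ∧ 1 ≤ i ∧
      i ≤ (if t = 0 then r - 1 else r) ∧ lead U r p d j =
        J U r p 5 ^ t * J U r p (i + 5) * J U r p (r + 5) ^ (j - t - 1)) := by
  rcases le_or_gt d 0 with h | h
  · obtain ⟨s, rfl⟩ : ∃ s : ℕ, d = -s := ⟨(-d).toNat, by omega⟩
    refine Or.inl ⟨0, by omega, ?_⟩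
    have : lowering (-s) + raising r (-s) j = s := by simp only [lowering, raising]; omega
    rw [this, lead_of_nonpos, zero_mul]
  rcases le_or_gt ((r * j : ℕ) : ℤ) d with h' | h'
  · obtain ⟨s, rfl⟩ : ∃ s : ℕ, d = (r * j : ℕ) + s := ⟨(d - (r * j : ℕ)).toNat, by omega⟩
    refine Or.inl ⟨1, by omega, ?_⟩
    have : lowering ((r * j : ℕ) + s) + raising r ((r * j : ℕ) + s) j = s := by
      simp only [lowering, raising]; omega
    rw [this, lead_of_ge, one_mul]
  · obtain ⟨n, rfl⟩ : ∃ n : ℕ, d = (n + 1 : ℕ) := ⟨(d - 1).toNat, by omega⟩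
    have h' : n + 1 < r * j := by omega
    refine Or.inr ⟨by simp only [lowering, raising]; omega, ?_⟩
    have h1 : n % r + r * (n / r) = n := Nat.mod_add_div n r
    have h2 : n / r < j := Nat.div_lt_of_lt_mul (by omega)
    have h3 : n % r < r := Nat.mod_lt n hr
    generalize n / r = u at h1 h2
    generalize n % r = i at h1 h3
    refine ⟨j - 1 - u, i + 1, by omega, by omega, ?_, ?_⟩
    · split_ifs with h4
      · have h5 : u + 1 = j := by omega
        rw [← h5, mul_add] at h'
        omega
      · omega
    · rw [lead_of_le h'.le, show j - (j - 1 - u) - 1 = u by omega, J_five_mul_mul,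
        show n + 1 = i + 1 + r * u by omega, show j - 1 - u + u + 1 = j by omega]

theorem effMonomials_eq (hr : 0 < r) :
    effMonomials U r p q = {T | ∃ (d : ℤ) (j n m : ℕ), m + j ≤ q ∧
      n + r * m + (lowering d + raising r d j) + j * r ≤ p ∧
      T = basisMonomial U r p d j n m} := by
  ext T
  constructor
  · rintro (⟨ε, s, j, n, m, hε, h1, h2, h3, h4, rfl⟩ |
      ⟨t, i, j, n, m, h1, h2, h3, h4, h5, h6, rfl⟩)
    · obtain ⟨d, hd, he⟩ := lead_of_extreme (U := U) (r := r) (p := p) hε s j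
      exact ⟨d, j, n, m, h3, by omega, by rw [he, basisMonomial]⟩
    · obtain ⟨d, hd, he⟩ := lead_of_middle (U := U) (r := r) (p := p) (i := i) h2
        (by split_ifs at h4 <;> omega)
      exact ⟨d, j, n, m, h5, by omega, by rw [he, basisMonomial]⟩
  · rintro ⟨d, j, n, m, h1, h2, rfl⟩
    rcases lead_cases (U := U) (p := p) hr d j with ⟨ε, hε, he⟩ | ⟨h0, t, i, h3, h4, h5, he⟩
    · exact Or.inl ⟨ε, _, j, n, m, hε, by omega, by omega, h1, h2, by rw [basisMonomial, he]⟩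
    · exact Or.inr ⟨t, i, j, n, m, by omega, h3, h4, h5, h1, by omega, by rw [basisMonomial, he]⟩

theorem bigMonomials_eq (hr : 0 < r) (k : ℕ) :
    bigMonomials U r p k = {T | ∃ (d : ℤ) (j n m : ℕ),
      lowering d + raising r d j + j + n + m ≤ k ∧ T = basisMonomial U r p d j n m} := by
  ext T
  constructor
  · rintro (⟨ε, j, l, t, n, hε, h1, h2, h3, h4, rfl⟩ |
      ⟨t, i, l, u, n, h1, h2, h3, h4, h5, h6, rfl⟩)
    · obtain ⟨d, hd, he⟩ := lead_of_extreme (U := U) (r := r) (p := p) hε (l - j) j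
      exact ⟨d, j, n, t - l - n, by omega, by rw [he, basisMonomial]⟩
    · obtain ⟨d, hd, he⟩ := lead_of_middle (U := U) (r := r) (p := p) (i := i) h1
        (by split_ifs at h6 <;> omega)
      exact ⟨d, l, n, u - l - n, by omega, by rw [he, basisMonomial]⟩
  · rintro ⟨d, j, n, m, h1, rfl⟩
    rcases lead_cases (U := U) (p := p) hr d j with ⟨ε, hε, he⟩ | ⟨h0, t, i, h3, h4, h5, he⟩
    · refine Or.inl ⟨ε, j, lowering d + raising r d j + j,
        lowering d + raising r d j + j + n + m, n, hε, by omega, by omega, h1, by omega, ?_⟩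
      rw [basisMonomial, he]
      congr 2
      · congr 2; omega
      · omega
    · refine Or.inr ⟨t, i, j, j + n + m, n, by omega, by omega, by omega, by omega, h4, h5, ?_⟩
      rw [basisMonomial, he]
      congr 1
      congr 1
      omega

/-! ### Symmetrized products against ordinary products -/

section Symmetrization

variable {A : Type} [Ring A] [Algebra ℂ A] (V : Submodule ℂ A)

theorem list_prod_mem_pow (W : Submodule ℂ A) (L : List A) (hL : ∀ x ∈ L, x ∈ W) :
    L.prod ∈ W ^ L.length := by
  induction L with
  | nil => exact Submodule.one_le.1 le_rfl
  | cons x L ih =>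
    rw [List.prod_cons, List.length_cons, pow_succ']
    exact Submodule.mul_mem_mul (hL x (by simp)) (ih fun y hy => hL y (by simp [hy]))

theorem pow_le_span_list_prod (n : ℕ) :
    V ^ n ≤ Submodule.span ℂ {a | ∃ L : List A, L.length = n ∧ (∀ x ∈ L, x ∈ V) ∧ a = L.prod} := by
  refine pow_le_of_mul_le V (fun n => Submodule.span ℂ
    {a | ∃ L : List A, L.length = n ∧ (∀ x ∈ L, x ∈ V) ∧ a = L.prod})
    (Submodule.subset_span ⟨[], rfl, by simp, by simp⟩) (fun k => ?_) n
  refine Submodule.mul_le.2 fun x hx a ha => ?_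
  induction ha using Submodule.span_induction with
  | mem a h =>
    obtain ⟨L, h1, h2, rfl⟩ := h
    refine Submodule.subset_span ⟨x :: L, by simp [h1], fun y hy => ?_, List.prod_cons.symm⟩
    rcases List.mem_cons.1 hy with rfl | hy
    · exact hx
    · exact h2 y hy
  | zero => rw [mul_zero]; exact zero_mem _
  | add a b _ _ ha hb => rw [mul_add]; exact add_mem ha hb
  | smul c a _ ha => rw [mul_smul_comm]; exact Submodule.smul_mem _ c ha

/-- Reordering a product of elements of a Lie subalgebra changes it by shorter products. -/
theorem list_prod_sub_mem_of_perm (hV : ∀ x ∈ V, ∀ y ∈ V, x * y - y * x ∈ V) {L L' : List A}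
    (h : L.Perm L') (hL : ∀ x ∈ L, x ∈ V) : L.prod - L'.prod ∈ (1 ⊔ V) ^ (L.length - 1) := by
  have hW : V ≤ 1 ⊔ V := le_sup_right
  induction h with
  | nil => simp
  | @cons x l l' hl ih =>
    rw [List.prod_cons, List.prod_cons, ← mul_sub, List.length_cons, Nat.add_sub_cancel]
    have ih := ih fun y hy => hL y (by simp [hy])
    rcases Nat.eq_zero_or_pos l.length with h0 | h0
    · rw [List.length_eq_zero_iff] at h0
      subst h0
      rw [List.nil_perm.1 hl, sub_self, mul_zero]
      exact zero_mem _
    · rw [← Nat.sub_add_cancel h0, pow_succ']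
      exact Submodule.mul_mem_mul (hW (hL x (by simp))) ih
  | swap x y l =>
    have h1 := hV y (hL y (by simp)) x (hL x (by simp))
    have h2 := list_prod_mem_pow (1 ⊔ V) l fun z hz => hW (hL z (by simp [hz]))
    have e : (y :: x :: l).prod - (x :: y :: l).prod = (y * x - x * y) * l.prod := by
      simp only [List.prod_cons]; noncomm_ring
    rw [e, List.length_cons, List.length_cons, Nat.add_sub_cancel, pow_succ']
    exact Submodule.mul_mem_mul (hW h1) h2
  | trans h1 h2 ih1 ih2 =>
    have i1 := ih1 hL
    have i2 := ih2 fun x hx => hL x (h1.mem_iff.2 hx)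
    rw [← h1.length_eq] at i2
    simpa using add_mem i1 i2

theorem symmProd_apply (n : ℕ) (v : Fin n → V) :
    symmProd V n v = ((n.factorial : ℂ)⁻¹) • ∑ σ : Equiv.Perm (Fin n),
      (List.ofFn fun i => (v (σ i) : A)).prod := by
  simp [symmProd, MultilinearMap.domDomCongr_apply]

theorem symmProd_mem_range {n k : ℕ} (h : n ≤ k) (v : Fin n → V) :
    symmProd V n v ∈ LinearMap.range (symmUpTo V k) := by
  refine ⟨Pi.single (⟨n, Nat.lt_succ_of_le h⟩ : Fin (k + 1)) (SymmetricPower.tprod ℂ v), ?_⟩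
  rw [symmUpTo, LinearMap.sum_apply, Finset.sum_eq_single ⟨n, Nat.lt_succ_of_le h⟩]
  · rw [LinearMap.comp_apply, LinearMap.proj_apply, Pi.single_eq_same, symmPow_tprod]
  · intro m _ hm
    rw [LinearMap.comp_apply, LinearMap.proj_apply, Pi.single_eq_of_ne hm, map_zero]
  · intro h'; exact absurd (mem_univ _) h'

theorem range_symmUpTo_le {k : ℕ} {S : Submodule ℂ A}
    (h : ∀ n ≤ k, ∀ v : Fin n → V, symmProd V n v ∈ S) : LinearMap.range (symmUpTo V k) ≤ S := by
  rintro _ ⟨x, rfl⟩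
  rw [symmUpTo, LinearMap.sum_apply]
  refine sum_mem fun n _ => ?_
  rw [LinearMap.comp_apply]
  refine AddCon.induction_on (LinearMap.proj (R := ℂ) n x) fun t => ?_
  change PiTensorProduct.lift (symmProd V n) t ∈ S
  induction t using PiTensorProduct.induction_on with
  | smul_tprod c v =>
    rw [map_smul, PiTensorProduct.lift.tprod]
    exact Submodule.smul_mem _ c (h n (Nat.lt_succ_iff.1 n.2) v)
  | add s t hs ht => rw [map_add]; exact add_mem hs ht

theorem one_sup_pow_mono {k l : ℕ} (h : k ≤ l) : (1 ⊔ V) ^ k ≤ (1 ⊔ V) ^ l :=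
  pow_le_pow_right' le_sup_left h

/-- In passing from `k` to `k + 1`, only products of exactly `k + 1` elements of `V` are new. -/
theorem one_sup_pow_succ_le (k : ℕ) : (1 ⊔ V) ^ (k + 1) ≤ (1 ⊔ V) ^ k ⊔ V ^ (k + 1) := by
  induction k with
  | zero => simp
  | succ k ih =>
    rw [pow_succ' _ (k + 1), Submodule.sup_mul, one_mul]
    refine sup_le le_sup_left ?_
    refine (mul_le_mul' le_rfl ih).trans ?_
    rw [Submodule.mul_sup, ← pow_succ']
    refine sup_le_sup_right ?_ _
    rw [pow_succ']
    exact mul_le_mul' le_sup_right le_rfl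

/-- The symmetrized products of at most `k` elements of a Lie subalgebra span the same space as the
products of at most `k` elements. -/
theorem range_symmUpTo (hV : ∀ x ∈ V, ∀ y ∈ V, x * y - y * x ∈ V) (k : ℕ) :
    LinearMap.range (symmUpTo V k) = (1 ⊔ V) ^ k := by
  have hW : V ≤ 1 ⊔ V := le_sup_right
  refine le_antisymm (range_symmUpTo_le V fun n hn v => ?_) ?_
  · rw [symmProd_apply]
    refine Submodule.smul_mem _ _ (sum_mem fun σ _ => ?_)
    have := list_prod_mem_pow (1 ⊔ V) (List.ofFn fun i => (v (σ i) : A)) fun x hx => by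
      obtain ⟨i, rfl⟩ := List.mem_ofFn.1 hx
      exact hW (v (σ i)).2
    rw [List.length_ofFn] at this
    exact one_sup_pow_mono V hn this
  · induction k with
    | zero =>
      rw [pow_zero, Submodule.one_le]
      have := symmProd_mem_range V le_rfl (Fin.elim0 : Fin 0 → V)
      simpa [symmProd_apply] using this
    | succ k ih =>
      have ih : (1 ⊔ V) ^ k ≤ LinearMap.range (symmUpTo V (k + 1)) :=
        ih.trans (range_symmUpTo_le V fun n hn v => symmProd_mem_range V (by omega) v)
      refine (one_sup_pow_succ_le V k).trans (sup_le ih ?_)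
      refine (pow_le_span_list_prod V (k + 1)).trans (Submodule.span_le.2 ?_)
      rintro _ ⟨L, hlen, hL, rfl⟩
      obtain ⟨v, rfl⟩ : ∃ v : Fin (k + 1) → V, L = List.ofFn fun i => (v i : A) := by
        refine ⟨fun i => ⟨L[i.1]'(by omega), hL _ (List.getElem_mem _)⟩, ?_⟩
        exact List.ext_getElem (by simp [hlen]) fun i h1 h2 => by rw [List.getElem_ofFn]
      -- A product is its symmetrization plus the average of its differences from the reordered
      -- products; these differences have length at most `k`.
      have e : (List.ofFn fun i => (v i : A)).prod = symmProd V (k + 1) v +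
          (((k + 1).factorial : ℂ)⁻¹) • ∑ σ : Equiv.Perm (Fin (k + 1)),
            ((List.ofFn fun i => (v i : A)).prod - (List.ofFn fun i => (v (σ i) : A)).prod) := by
        rw [symmProd_apply, ← smul_add, ← Finset.sum_add_distrib]
        simp only [add_sub_cancel, Finset.sum_const, Finset.card_univ, Fintype.card_perm,
          Fintype.card_fin]
        rw [← Nat.cast_smul_eq_nsmul ℂ, smul_smul, inv_mul_cancel₀, one_smul]
        exact Nat.cast_ne_zero.2 (Nat.factorial_ne_zero _)
      rw [SetLike.mem_coe, e]
      refine add_mem (symmProd_mem_range V le_rfl v)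
        (Submodule.smul_mem _ _ (sum_mem fun σ _ => ih ?_))
      have := list_prod_sub_mem_of_perm V hV
        (L' := List.ofFn fun i => (v (σ i) : A)) ?_ hL
      · rwa [List.length_ofFn, Nat.add_sub_cancel] at this
      · exact (Equiv.Perm.ofFn_comp_perm σ fun i => (v i : A)).symm

end Symmetrization

/-! ### The Lie algebra and the span of its products -/

theorem IsHom.add {S T : Op U} {d e : ℤ} {c c' : ℂ → ℂ → ℂ} (hS : IsHom S d e c)
    (hT : IsHom T d e c') : IsHom (S + T) d e fun a b => c a b + c' a b := by
  intro a b
  refine ⟨fun h => ?_, by rw [LinearMap.add_apply, (hS a b).2, (hT a b).2, add_smul]⟩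
  by_cases h' : c a b = 0
  · exact (hT a b).1 fun h'' => h (by simp [h', h''])
  · exact (hS a b).1 h'

theorem IsHom.smul {T : Op U} {d e : ℤ} {c : ℂ → ℂ → ℂ} (hT : IsHom T d e c) (κ : ℂ) :
    IsHom (κ • T) d e fun a b => κ * c a b := by
  intro a b
  exact ⟨fun h => (hT a b).1 (right_ne_zero_of_mul h),
    by rw [LinearMap.smul_apply, (hT a b).2, smul_smul]⟩

theorem IsHom.zero (d e : ℤ) : IsHom (0 : Op U) d e fun _ _ => 0 := fun a b => by simp

theorem IsHom.eq {S T : Op U} {d e : ℤ} {c c' : ℂ → ℂ → ℂ} (hS : IsHom S d e c)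
    (hT : IsHom T d e c') (hS' : S ∈ diffOp U) (hT' : T ∈ diffOp U) (h : ∀ a b, c a b = c' a b) :
    S = T :=
  eq_of_mon_of_mem_diffOp hS' hT' fun a b => by rw [(hS a b).2, (hT a b).2, h]

theorem J_mem_diffOpLE {i : ℕ} (hi : 1 ≤ i) : J U r p i ∈ diffOpLE U 1 := by
  have hx (f : Smooth U) : mulOp f * dx U ∈ diffOpLE U 1 := by
    simpa [diffOpLE] using mulOp_mul_mem f (dx_mul_mem (one_mem_diffOpLE (U := U) 0))
  have hy (f : Smooth U) : mulOp f * dy U ∈ diffOpLE U 1 := by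
    simpa [diffOpLE] using mulOp_mul_mem f (dy_mul_mem (one_mem_diffOpLE (U := U) 0))
  have h1 (f : Smooth U) : mulOp f ∈ diffOpLE U 1 := by
    simpa [diffOpLE] using mulOp_mul_mem f (one_mem_diffOpLE (U := U) 1)
  match i, hi with
  | 1, _ =>
    have := hx 1
    rwa [mulOp_one, one_mul] at this
  | 2, _ =>
    exact sub_mem (add_mem (hx _) (Submodule.smul_mem _ _ (hy _)))
      (Submodule.smul_mem _ _ (h1 _))
  | 3, _ => exact sub_mem (hx _) (Submodule.smul_mem _ _ (one_mem_diffOpLE 1))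
  | 4, _ => exact hy _
  | i + 5, _ => exact hy _

theorem J_mem_g24 {i : ℕ} (h1 : 1 ≤ i) (h2 : i ≤ r + 5) : J U r p i ∈ g24 U r p :=
  Submodule.subset_span ⟨i, h1, h2, rfl⟩

theorem g24_le_diffOpLE : g24 U r p ≤ diffOpLE U 1 :=
  Submodule.span_le.2 fun _ ⟨_, h1, _, h⟩ => h ▸ J_mem_diffOpLE h1

theorem one_sup_g24_pow_le (k : ℕ) : (1 ⊔ g24 U r p) ^ k ≤ diffOpLE U k := by
  refine le_trans ?_ (diffOpLE_one_pow_le k)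
  exact pow_le_pow_left' (sup_le (Submodule.one_le.2 (one_mem_diffOpLE 1)) g24_le_diffOpLE) k

/-- Homogeneous differential operators of the same bidegree agree when their weights do, which
reduces a commutator relation to a polynomial identity. -/
theorem commutator_eq {S T R : Op U} {d₁ e₁ d₂ e₂ d e : ℤ} {c₁ c₂ c : ℂ → ℂ → ℂ}
    (hS : IsHom S d₁ e₁ c₁) (hT : IsHom T d₂ e₂ c₂) (hR : IsHom R d e c)
    (hS' : S ∈ diffOpLE U 1) (hT' : T ∈ diffOpLE U 1) (hR' : R ∈ diffOpLE U 1)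
    (hd : d₁ + d₂ = d) (he : e₁ + e₂ = e)
    (h : ∀ a b, c₂ a b * c₁ (a + d₂) (b + e₂) - c₁ a b * c₂ (a + d₁) (b + e₁) = c a b) :
    S * T - T * S = R := by
  subst hd he
  have h1 := (hT.mul hS).smul (-1)
  have h2 := ((hS.mul hT).congr (add_comm _ _) (add_comm _ _) fun _ _ => rfl).add h1
  have h3 {S T : Op U} (hS' : S ∈ diffOpLE U 1) (hT' : T ∈ diffOpLE U 1) : S * T ∈ diffOp U :=
    diffOpLE_le 2 (diffOpLE_one_mul_le 1 (Submodule.mul_mem_mul hS' hT'))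
  have h4 : (-1 : ℂ) • (T * S) = -(T * S) := LinearMap.ext fun f => neg_one_smul ℂ _
  rw [h4, ← sub_eq_add_neg] at h2
  refine h2.eq hR (sub_mem (h3 hS' hT') (h3 hT' hS')) (diffOpLE_le 1 hR') fun a b => ?_
  rw [← h]
  ring

theorem commutator_J_mem {i j : ℕ} (hi : 1 ≤ i) (hij : i ≤ j) (hj : j ≤ r + 5) :
    J U r p i * J U r p j - J U r p j * J U r p i ∈ g24 U r p := by
  have key {d e : ℤ} {c : ℂ → ℂ → ℂ} {k : ℕ} (h1 : 1 ≤ k) (h2 : k ≤ r + 5) (κ : ℂ)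
      (hR : IsHom (J U r p k) d e c) {d₁ e₁ d₂ e₂ : ℤ} {c₁ c₂ : ℂ → ℂ → ℂ}
      (hS : IsHom (J U r p i) d₁ e₁ c₁) (hT : IsHom (J U r p j) d₂ e₂ c₂)
      (hd : d₁ + d₂ = d) (he : e₁ + e₂ = e)
      (h : ∀ a b, c₂ a b * c₁ (a + d₂) (b + e₂) - c₁ a b * c₂ (a + d₁) (b + e₁) = κ * c a b) :
      J U r p i * J U r p j - J U r p j * J U r p i ∈ g24 U r p := by
    rw [commutator_eq hS hT (hR.smul κ) (J_mem_diffOpLE hi) (J_mem_diffOpLE (hi.trans hij))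
      (Submodule.smul_mem _ _ (J_mem_diffOpLE h1)) hd he h]
    exact Submodule.smul_mem _ _ (J_mem_g24 h1 h2)
  have key0 {d₁ e₁ d₂ e₂ : ℤ} {c₁ c₂ : ℂ → ℂ → ℂ}
      (hS : IsHom (J U r p i) d₁ e₁ c₁) (hT : IsHom (J U r p j) d₂ e₂ c₂)
      (h : ∀ a b, c₂ a b * c₁ (a + d₂) (b + e₂) - c₁ a b * c₂ (a + d₁) (b + e₁) = 0) :
      J U r p i * J U r p j - J U r p j * J U r p i ∈ g24 U r p := by
    rw [commutator_eq hS hT (IsHom.zero _ _) (J_mem_diffOpLE hi) (J_mem_diffOpLE (hi.trans hij))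
      (zero_mem _) rfl rfl h]
    exact zero_mem _
  by_cases e : i = j
  · rw [e, sub_self]; exact zero_mem _
  match i, j, hi, hij, hj with
  -- The commutator of `J^1` and `J^2` is `2 J^3 + r J^4`, the only one that needs two generators.
  | 1, 2, _, _, _ =>
    rw [commutator_eq isHom_J_one isHom_J_two
      (((isHom_J_three (r := r) (p := p)).smul 2).add ((isHom_J_four (r := r) (p := p)).smul r))
      (J_mem_diffOpLE (by omega))
      (J_mem_diffOpLE (by omega)) (add_mem (Submodule.smul_mem _ _ (J_mem_diffOpLE (by omega)))
        (Submodule.smul_mem _ _ (J_mem_diffOpLE (by omega)))) (by norm_num) (by norm_num)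
      fun a b => by push_cast; ring]
    exact add_mem (Submodule.smul_mem _ _ (J_mem_g24 (by omega) (by omega)))
        (Submodule.smul_mem _ _ (J_mem_g24 (by omega) (by omega)))
  | 1, 3, _, _, _ =>
    exact key (k := 1) (by omega) (by omega) 1 isHom_J_one isHom_J_one isHom_J_three (by norm_num)
      (by norm_num) fun a b => by push_cast; ring
  | 1, 4, _, _, _ => exact key0 isHom_J_one isHom_J_four fun a b => by push_cast; ring
  | 1, 5, _, _, _ =>
    exact key0 isHom_J_one (isHom_J_add_five 0) fun a b => by push_cast; ring
  | 1, l + 6, _, _, _ =>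
    exact key (k := l + 5) (by omega) (by omega) (l + 1) (isHom_J_add_five l) isHom_J_one
      (isHom_J_add_five (l + 1)) (by push_cast; ring) (by norm_num) fun a b => by push_cast; ring
  | 2, 3, _, _, _ =>
    exact key (k := 2) (by omega) (by omega) (-1) isHom_J_two isHom_J_two isHom_J_three
      (by norm_num) (by norm_num) fun a b => by push_cast; ring
  | 2, 4, _, _, _ => exact key0 isHom_J_two isHom_J_four fun a b => by push_cast; ring
  | 2, l + 5, _, _, hj =>
    -- The structure constant `l - r` vanishes at `l = r`, so `J^2` never leads beyond `x^r ∂_y`.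
    by_cases hl : l = r
    · subst hl
      exact key0 isHom_J_two (isHom_J_add_five l) fun a b => by push_cast; ring
    · exact key (k := l + 1 + 5) (by omega) (by omega) (l - r) (isHom_J_add_five (l + 1))
        isHom_J_two (isHom_J_add_five l) (by push_cast; ring) (by norm_num)
        fun a b => by push_cast; ring
  | 3, 4, _, _, _ => exact key0 isHom_J_three isHom_J_four fun a b => by push_cast; ring
  | 3, l + 5, _, _, _ =>
    exact key (k := l + 5) (by omega) (by omega) l (isHom_J_add_five l) isHom_J_three
      (isHom_J_add_five l) (by ring) (by norm_num) fun a b => by push_cast; ring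
  | 4, l + 5, _, _, _ =>
    exact key (k := l + 5) (by omega) (by omega) (-1) (isHom_J_add_five l) isHom_J_four
      (isHom_J_add_five l) (by ring) (by norm_num) fun a b => by push_cast; ring
  | i + 5, l + 5, _, _, _ =>
    exact key0 (isHom_J_add_five i) (isHom_J_add_five l) fun a b => by push_cast; ring

theorem commutator_mem_g24 : ∀ S ∈ g24 U r p, ∀ T ∈ g24 U r p, S * T - T * S ∈ g24 U r p := by
  intro S hS T hT
  induction hS, hT using Submodule.span_induction₂ with
  | mem_mem S T hS hT =>
    obtain ⟨i, h1, h2, rfl⟩ := hS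
    obtain ⟨j, h3, h4, rfl⟩ := hT
    rcases le_total i j with h | h
    · exact commutator_J_mem h1 h h4
    · rw [← neg_sub]
      exact neg_mem (commutator_J_mem h3 h h2)
  | zero_left T _ => simp
  | zero_right S _ => simp
  | add_left S S' T _ _ _ h h' =>
    rw [show (S + S') * T - T * (S + S') = (S * T - T * S) + (S' * T - T * S') by noncomm_ring]
    exact add_mem h h'
  | add_right S T T' _ _ _ h h' =>
    rw [show S * (T + T') - (T + T') * S = (S * T - T * S) + (S * T' - T' * S) by noncomm_ring]
    exact add_mem h h'
  | smul_left c S T _ _ h =>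
    rw [smul_mul_assoc, mul_smul_comm, ← smul_sub]
    exact Submodule.smul_mem _ c h
  | smul_right c S T _ _ h =>
    rw [smul_mul_assoc, mul_smul_comm, ← smul_sub]
    exact Submodule.smul_mem _ c h

/-- The polynomial functions of total degree at most `N` in two variables, spanned by the products
of powers of `a - p/2` and `b`. -/
def polyLE (p N : ℕ) : Submodule ℂ (ℂ → ℂ → ℂ) :=
  Submodule.span ℂ {f | ∃ n m : ℕ, n + m ≤ N ∧ f = fun a b : ℂ => (a - p / 2) ^ n * b ^ m}

theorem polyLE_mono {M N : ℕ} (h : M ≤ N) : polyLE p M ≤ polyLE p N :=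
  Submodule.span_mono fun _ ⟨n, m, h1, h2⟩ => ⟨n, m, h1.trans h, h2⟩

theorem monomial_mem_polyLE (n m : ℕ) :
    (fun a b => (a - p / 2) ^ n * b ^ m : ℂ → ℂ → ℂ) ∈ polyLE p (n + m) :=
  Submodule.subset_span ⟨n, m, le_rfl, rfl⟩

theorem mul_linear_mem_polyLE {N : ℕ} {f : ℂ → ℂ → ℂ} (hf : f ∈ polyLE p N) (α β γ : ℂ) :
    (fun a b => f a b * (α * a + β * b + γ)) ∈ polyLE p (N + 1) := by
  induction hf using Submodule.span_induction with
  | mem f h =>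
    obtain ⟨n, m, h, rfl⟩ := h
    have e : (fun a b : ℂ => (a - p / 2) ^ n * b ^ m * (α * a + β * b + γ)) =
        α • (fun a b : ℂ => (a - p / 2) ^ (n + 1) * b ^ m) +
        β • (fun a b : ℂ => (a - p / 2) ^ n * b ^ (m + 1)) +
        (γ + α * (p / 2)) • (fun a b : ℂ => (a - p / 2) ^ n * b ^ m) := by
      funext a b
      simp only [Pi.add_apply, Pi.smul_apply, smul_eq_mul]
      ring
    rw [e]
    exact add_mem (add_mem
      (Submodule.smul_mem _ _ (polyLE_mono (by omega) (monomial_mem_polyLE (n + 1) m)))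
      (Submodule.smul_mem _ _ (polyLE_mono (by omega) (monomial_mem_polyLE n (m + 1)))))
      (Submodule.smul_mem _ _ (polyLE_mono (by omega) (monomial_mem_polyLE n m)))
  | zero =>
    convert zero_mem (polyLE p (N + 1)) using 1
    funext a b
    simp
  | add f g _ _ hf hg =>
    convert add_mem hf hg using 1
    funext a b
    simp [add_mul]
  | smul c f _ hf =>
    convert Submodule.smul_mem _ c hf using 1
    funext a b
    simp [mul_assoc]

theorem mul_prod_mem_polyLE {N : ℕ} {f : ℂ → ℂ → ℂ} (hf : f ∈ polyLE p N) (α β : ℂ) (γ : ℕ → ℂ)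
    (s : Finset ℕ) :
    (fun a b => f a b * ∏ h ∈ s, (α * a + β * b + γ h)) ∈ polyLE p (N + s.card) := by
  classical
  induction s using Finset.induction_on with
  | empty => simpa using hf
  | insert x s hx ih =>
    rw [Finset.card_insert_of_notMem hx, ← add_assoc]
    convert mul_linear_mem_polyLE ih α β (γ x) using 1
    funext a b
    rw [Finset.prod_insert hx]
    ring

variable (U) in
/-- The span of the monomials with at most `k` factors. -/
def monomialSpan (r p k : ℕ) : Submodule ℂ (Op U) :=
  Submodule.span ℂ {T | ∃ (d : ℤ) (j n m : ℕ),
      lowering d + raising r d j + j + n + m ≤ k ∧ T = basisMonomial U r p d j n m}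

theorem basisMonomial_mem_one_sup_pow (hr : 0 < r) (d : ℤ) (j n m : ℕ) :
    basisMonomial U r p d j n m ∈
      (1 ⊔ g24 U r p) ^ (lowering d + raising r d j + j + n + m) := by
  have hg : g24 U r p ≤ 1 ⊔ g24 U r p := le_sup_right
  have hJ {i : ℕ} (h1 : 1 ≤ i) (h2 : i ≤ r + 5) (s : ℕ) :
      J U r p i ^ s ∈ (1 ⊔ g24 U r p) ^ s :=
    Submodule.pow_mem_pow _ (hg (J_mem_g24 h1 h2)) s
  have hmul {S T : Op U} {s t : ℕ} (hS : S ∈ (1 ⊔ g24 U r p) ^ s)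
      (hT : T ∈ (1 ⊔ g24 U r p) ^ t) : S * T ∈ (1 ⊔ g24 U r p) ^ (s + t) := by
    have := Submodule.mul_mem_mul hS hT
    exact (pow_add (1 ⊔ g24 U r p) s t).symm ▸ this
  refine hmul (hmul ?_ (hJ (by omega) (by omega) n)) (hJ (by omega) (by omega) m)
  rcases lead_cases (U := U) (p := p) hr d j with ⟨ε, hε, he⟩ | ⟨h0, t, i, h3, h4, h5, he⟩
  · rw [he]
    have : ε = 0 ∨ ε = 1 := by omega
    rcases this with rfl | rfl
    · exact hmul (hJ (by omega) (by omega) _) (hJ (by omega) (by omega) _)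
    · exact hmul (hJ (by omega) (by omega) _) (hJ (by omega) (by omega) _)
  · rw [he, h0]
    have hi : i ≤ r := by split_ifs at h5 <;> omega
    have e : 0 + j = t + 1 + (j - t - 1) := by omega
    rw [e]
    have h1 := hJ (i := i + 5) (by omega) (by omega) 1
    rw [pow_one] at h1
    exact hmul (hmul (hJ (by omega) (by omega) _) h1) (hJ (by omega) (by omega) _)

theorem basisMonomial_mem_diffOpLE (hr : 0 < r) (d : ℤ) (j n m : ℕ) :
    basisMonomial U r p d j n m ∈ diffOpLE U (lowering d + raising r d j + j + n + m) :=
  one_sup_g24_pow_le _ (basisMonomial_mem_one_sup_pow hr d j n m)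

theorem basisMonomial_mem_diffOp (hr : 0 < r) (d : ℤ) (j n m : ℕ) :
    basisMonomial U r p d j n m ∈ diffOp U :=
  diffOpLE_le _ (basisMonomial_mem_diffOpLE hr d j n m)

theorem monomialSpan_le (hr : 0 < r) (k : ℕ) :
    monomialSpan U r p k ≤ (1 ⊔ g24 U r p) ^ k := by
  refine Submodule.span_le.2 ?_
  rintro _ ⟨d, j, n, m, h, rfl⟩
  exact one_sup_pow_mono _ h (basisMonomial_mem_one_sup_pow hr d j n m)

theorem monomialSpan_mono {k l : ℕ} (h : k ≤ l) : monomialSpan U r p k ≤ monomialSpan U r p l :=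
  Submodule.span_mono fun _ ⟨d, j, n, m, h1, h2⟩ => ⟨d, j, n, m, h1.trans h, h2⟩

theorem monomialSpan_le_diffOp (hr : 0 < r) (k : ℕ) : monomialSpan U r p k ≤ diffOp U :=
  (monomialSpan_le hr k).trans ((one_sup_g24_pow_le k).trans (diffOpLE_le k))

/-- Expanding `f` in powers of `a - p/2` and `b` builds a combination of basis monomials with the
same weight, hence the same operator. This turns spanning into divisibility of weights by
`leadCoeff`. -/
theorem mem_monomialSpan_of_isHom (hr : 0 < r) {k N : ℕ} {T : Op U} (hT : T ∈ diffOp U) {d : ℤ}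
    {j : ℕ} {f : ℂ → ℂ → ℂ} (hf : f ∈ polyLE p N)
    (h : IsHom T d (-j) fun a b => leadCoeff r p d j a b * f a b)
    (hk : lowering d + raising r d j + j + N ≤ k) : T ∈ monomialSpan U r p k := by
  obtain ⟨S, hS, hS'⟩ : ∃ S ∈ monomialSpan U r p k,
      IsHom S d (-j) fun a b => leadCoeff r p d j a b * f a b := by
    clear h
    induction hf using Submodule.span_induction with
    | mem f h =>
      obtain ⟨n, m, h, rfl⟩ := h
      exact ⟨basisMonomial U r p d j n m,
        Submodule.subset_span ⟨d, j, n, m, by omega, rfl⟩, isHom_basisMonomial d j n m⟩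
    | zero => exact ⟨0, zero_mem _, (IsHom.zero _ _).congr rfl rfl fun a b => by simp⟩
    | add f g _ _ hf hg =>
      obtain ⟨S, hS, hS'⟩ := hf
      obtain ⟨T, hT, hT'⟩ := hg
      exact ⟨S + T, add_mem hS hT, (hS'.add hT').congr rfl rfl fun a b => by
        simp [mul_add]⟩
    | smul c f _ hf =>
      obtain ⟨S, hS, hS'⟩ := hf
      exact ⟨c • S, Submodule.smul_mem _ c hS, (hS'.smul c).congr rfl rfl fun a b => by
        simp only [Pi.smul_apply, smul_eq_mul]; ring⟩
  rw [h.eq hS' hT (monomialSpan_le_diffOp hr k hS) fun _ _ => rfl]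
  exact hS

/-- The new weight is divisible by `leadCoeff` of the new bidegree. Either the generator supplies
the next linear factor of a product, or the new products are no longer than the old ones; surplus
factors (those over `Ico`) pass into the polynomial. The total degree rises by at most one. -/
theorem J_mul_basisMonomial_mem (hr : 0 < r) {i : ℕ} (h1 : 1 ≤ i) (h2 : i ≤ r + 5) (d : ℤ)
    (j n m : ℕ) : J U r p i * basisMonomial U r p d j n m ∈
      monomialSpan U r p (lowering d + raising r d j + j + n + m + 1) := by
  have hT : J U r p i * basisMonomial U r p d j n m ∈ diffOp U :=
    diffOpLE_le _ (diffOpLE_one_mul_le _ (Submodule.mul_mem_mul (J_mem_diffOpLE h1)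
      (basisMonomial_mem_diffOpLE hr d j n m)))
  have hM := isHom_basisMonomial (U := U) (r := r) (p := p) d j n m
  have hf : (fun a b => (a - p / 2) ^ n * b ^ m : ℂ → ℂ → ℂ) ∈ polyLE p (n + m) :=
    monomial_mem_polyLE n m
  have hsplit (g : ℕ → ℂ) {s t : ℕ} (h : s ≤ t) :
      ∏ h ∈ range t, g h = (∏ h ∈ range s, g h) * ∏ h ∈ Ico s t, g h :=
    (Finset.prod_range_mul_prod_Ico g h).symm
  match i, h1, h2 with
  | 1, _, _ =>
    rcases le_or_gt d 0 with hd | hd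
    -- After the shift the weight of `J^1` is `a + d = a - lowering d`, precisely the next factor.
    · have e1 : lowering (d - 1) = lowering d + 1 := by simp only [lowering]; omega
      have e2 : raising r (d - 1) j = raising r d j := by simp only [raising]; omega
      refine mem_monomialSpan_of_isHom hr (d := d - 1) (j := j) hT hf
        ((isHom_J_one.mul hM).congr (by ring) (by ring) fun a b => ?_) (by omega)
      have e3 : ((lowering d : ℕ) : ℂ) = -d := by
        rw [← Int.cast_natCast, lowering, Int.toNat_of_nonneg (by omega)]; push_cast; rfl
      rw [leadCoeff, leadCoeff, e1, e2, Finset.prod_range_succ, e3]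
      ring
    · have e1 : lowering (d - 1) = lowering d := by simp only [lowering]; omega
      have e2 : raising r (d - 1) j ≤ raising r d j := by simp only [raising]; omega
      refine mem_monomialSpan_of_isHom hr (d := d - 1) (j := j) hT
        (mul_linear_mem_polyLE (mul_prod_mem_polyLE hf 1 r (fun h => -p + h)
          (Ico (raising r (d - 1) j) (raising r d j))) 1 0 d)
        ((isHom_J_one.mul hM).congr (by ring) (by ring) fun a b => ?_)
        (by rw [Nat.card_Ico]; omega)
      have e3 : ∏ h ∈ Ico (raising r (d - 1) j) (raising r d j), (1 * a + r * b + (-p + (h : ℂ))) =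
          ∏ h ∈ Ico (raising r (d - 1) j) (raising r d j), (a + r * b - p + (h : ℂ)) :=
        Finset.prod_congr rfl fun h _ => by ring
      rw [leadCoeff, leadCoeff, e1, hsplit _ e2, e3]
      ring
  | 2, _, _ =>
    rcases le_or_gt ((r * j : ℕ) : ℤ) d with hd | hd
    · have e1 : lowering (d + 1) = lowering d := by simp only [lowering]; omega
      have e2 : raising r (d + 1) j = raising r d j + 1 := by simp only [raising]; omega
      refine mem_monomialSpan_of_isHom hr (d := d + 1) (j := j) hT hf
        ((isHom_J_two.mul hM).congr (by ring) (by ring) fun a b => ?_) (by omega)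
      have e3 : ((raising r d j : ℕ) : ℂ) = d - r * j := by
        rw [← Int.cast_natCast, raising, Int.toNat_of_nonneg (by omega)]; push_cast; rfl
      rw [leadCoeff, leadCoeff, e1, e2, Finset.prod_range_succ, e3]
      push_cast
      ring
    · have e1 : lowering (d + 1) ≤ lowering d := by simp only [lowering]; omega
      have e2 : raising r (d + 1) j = raising r d j := by simp only [raising]; omega
      refine mem_monomialSpan_of_isHom hr (d := d + 1) (j := j) hT
        (mul_linear_mem_polyLE (mul_prod_mem_polyLE hf 1 0 (fun h => -h)
          (Ico (lowering (d + 1)) (lowering d))) 1 r (d - r * j - p))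
        ((isHom_J_two.mul hM).congr (by ring) (by ring) fun a b => ?_)
        (by rw [Nat.card_Ico]; omega)
      have e3 : ∏ h ∈ Ico (lowering (d + 1)) (lowering d), (1 * a + 0 * b + -(h : ℂ)) =
          ∏ h ∈ Ico (lowering (d + 1)) (lowering d), (a - (h : ℂ)) :=
        Finset.prod_congr rfl fun h _ => by ring
      rw [leadCoeff, leadCoeff, e2, hsplit _ e1, e3]
      push_cast
      ring
  | 3, _, _ =>
    refine mem_monomialSpan_of_isHom hr (d := d) (j := j) hT
      (mul_linear_mem_polyLE hf 1 0 (d - p / 2))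
      ((isHom_J_three.mul hM).congr (by ring) (by ring) fun a b => ?_) (by omega)
    ring
  | 4, _, _ =>
    refine mem_monomialSpan_of_isHom hr (d := d) (j := j) hT
      (mul_linear_mem_polyLE hf 0 1 (-j))
      ((isHom_J_four.mul hM).congr (by ring) (by ring) fun a b => ?_) (by omega)
    push_cast
    ring
  | i + 5, _, h2 =>
    have e1 : lowering (d + i) ≤ lowering d := by simp only [lowering]; omega
    -- Here `i ≤ r` enters: `d + i - r (j + 1)` does not exceed `d - r j`.
    have e2 : raising r (d + i) (j + 1) ≤ raising r d j := by
      simp only [raising, mul_add]; omega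
    refine mem_monomialSpan_of_isHom hr (d := d + i) (j := j + 1) hT
      (mul_prod_mem_polyLE (mul_prod_mem_polyLE hf 1 0 (fun h => -h)
          (Ico (lowering (d + i)) (lowering d))) 1 r (fun h => -p + h)
          (Ico (raising r (d + i) (j + 1)) (raising r d j)))
      (((isHom_J_add_five i).mul hM).congr (by ring) (by push_cast; ring) fun a b => ?_)
      (by rw [Nat.card_Ico, Nat.card_Ico]; omega)
    have e3 : ∏ h ∈ Ico (lowering (d + i)) (lowering d), (1 * a + 0 * b + -(h : ℂ)) =
        ∏ h ∈ Ico (lowering (d + i)) (lowering d), (a - (h : ℂ)) :=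
      Finset.prod_congr rfl fun h _ => by ring
    have e4 : ∏ h ∈ Ico (raising r (d + i) (j + 1)) (raising r d j),
          (1 * a + r * b + (-p + (h : ℂ))) =
        ∏ h ∈ Ico (raising r (d + i) (j + 1)) (raising r d j), (a + r * b - p + (h : ℂ)) :=
      Finset.prod_congr rfl fun h _ => by ring
    rw [leadCoeff, leadCoeff, hsplit _ e1, hsplit _ e2, e3, e4, Finset.prod_range_succ]
    push_cast
    ring

theorem one_sup_g24_mul_monomialSpan_le (hr : 0 < r) (k : ℕ) :
    (1 ⊔ g24 U r p) * monomialSpan U r p k ≤ monomialSpan U r p (k + 1) := by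
  rw [Submodule.sup_mul]
  refine sup_le ?_ (Submodule.mul_le.2 fun S hS T hT => ?_)
  · refine Submodule.mul_le.2 fun S hS T hT => ?_
    obtain ⟨c, rfl⟩ := Submodule.mem_one.1 hS
    rw [← Algebra.smul_def]
    exact Submodule.smul_mem _ c (monomialSpan_mono (Nat.le_succ k) hT)
  · induction hS, hT using Submodule.span_induction₂ with
    | mem_mem S T hS hT =>
      obtain ⟨i, h1, h2, rfl⟩ := hS
      obtain ⟨d, j, n, m, h, rfl⟩ := hT
      exact monomialSpan_mono (by omega) (J_mul_basisMonomial_mem hr h1 h2 d j n m)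
    | zero_left T _ => rw [zero_mul]; exact zero_mem _
    | zero_right S _ => rw [mul_zero]; exact zero_mem _
    | add_left S S' T _ _ _ h h' => rw [add_mul]; exact add_mem h h'
    | add_right S T T' _ _ _ h h' => rw [mul_add]; exact add_mem h h'
    | smul_left c S T _ _ h => rw [smul_mul_assoc]; exact Submodule.smul_mem _ c h
    | smul_right c S T _ _ h => rw [mul_smul_comm]; exact Submodule.smul_mem _ c h

theorem one_mem_monomialSpan (k : ℕ) : 1 ∈ monomialSpan U r p k := by
  refine Submodule.subset_span ⟨0, 0, 0, 0, by simp [lowering, raising], ?_⟩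
  have := lead_of_nonpos (U := U) (r := r) (p := p) 0 0
  rw [Nat.cast_zero, neg_zero] at this
  simp [basisMonomial, this]

theorem span_bigMonomials (hr : 0 < r) (k : ℕ) :
    Submodule.span ℂ (bigMonomials U r p k) = LinearMap.range (rho U r p k) := by
  rw [rho, range_symmUpTo _ commutator_mem_g24, bigMonomials_eq hr]
  exact le_antisymm (monomialSpan_le hr k) (pow_le_of_mul_le _ _ (one_mem_monomialSpan 0)
    (one_sup_g24_mul_monomialSpan_le hr) k)

theorem range_rho_le (k : ℕ) : LinearMap.range (rho U r p k) ≤ diffOpLE U k := by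
  rw [rho, range_symmUpTo _ commutator_mem_g24]
  exact one_sup_g24_pow_le k

/-! ### Linear independence of the monomials -/

variable (U) in
/-- The monomials of both families, indexed by pairs `((d, j), (n, m))`. -/
def basisFamily (r p : ℕ) (x : (ℤ × ℕ) × (ℕ × ℕ)) : Op U :=
  basisMonomial U r p x.1.1 x.1.2 x.2.1 x.2.2

theorem leadCoeff_ne_zero {d : ℤ} {j a b : ℕ} (ha : lowering d ≤ a) (hb : j ≤ b)
    (h : ∀ i < raising r d j, a + r * b + i ≠ p) : leadCoeff r p d j a b ≠ 0 := by
  refine mul_ne_zero (mul_ne_zero ?_ ?_) ?_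
  · refine Finset.prod_ne_zero_iff.2 fun i hi => sub_ne_zero.2 fun e => ?_
    have := mem_range.1 hi
    have := Nat.cast_injective e
    omega
  · refine Finset.prod_ne_zero_iff.2 fun i hi e => h i (mem_range.1 hi) ?_
    have : ((a + r * b + i : ℕ) : ℂ) = (p : ℕ) := by
      push_cast
      linear_combination e
    exact Nat.cast_injective this
  · refine Finset.prod_ne_zero_iff.2 fun i hi => sub_ne_zero.2 fun e => ?_
    have := mem_range.1 hi
    have := Nat.cast_injective e
    omega

/-- On the staircase, each violated bound makes a linear factor vanish: `h = a`, `h = b` or `h = p -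
(a + r b)`. -/
theorem bounds_of_leadCoeff_ne_zero {d : ℤ} {j a b : ℕ} (hp : a + r * b ≤ p)
    (h : leadCoeff r p d j a b ≠ 0) :
    lowering d ≤ a ∧ j ≤ b ∧ a + r * b + raising r d j ≤ p := by
  rw [leadCoeff] at h
  refine ⟨?_, ?_, ?_⟩
  · by_contra h'
    exact Finset.prod_ne_zero_iff.1 (right_ne_zero_of_mul h) a (mem_range.2 (not_le.1 h'))
      (sub_self _)
  · by_contra h'
    exact Finset.prod_ne_zero_iff.1 (left_ne_zero_of_mul (left_ne_zero_of_mul h)) b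
      (mem_range.2 (not_le.1 h')) (sub_self _)
  · by_contra h'
    refine Finset.prod_ne_zero_iff.1 (right_ne_zero_of_mul (left_ne_zero_of_mul h))
      (p - (a + r * b)) (mem_range.2 (by omega)) ?_
    rw [Nat.cast_sub hp]
    push_cast
    ring

/-- If a combination of the monomials kills `x^a y^b` for enough exponents, then the coefficients in
a given bidegree vanish. -/
theorem coefficient_eq_zero (hU : (U : Set (ℂ × ℂ)).Nonempty) (c : (ℤ × ℕ) × (ℕ × ℕ) →₀ ℂ)
    (d : ℤ) (j : ℕ) (D : Finset (ℕ × ℕ))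
    (hD : ∀ i j i' j', (i, j) ∈ D → i' ≤ i → j' ≤ j → (i', j') ∈ D)
    (hc : ∀ y, c ((d, j), y) ≠ 0 → y ∈ D) (a₀ b₀ : ℕ)
    (hlead : ∀ x ∈ D, leadCoeff r p d j ((a₀ + x.1 : ℕ) : ℂ) ((b₀ + x.2 : ℕ) : ℂ) ≠ 0)
    (h : ∀ x ∈ D,
      (Finsupp.linearCombination ℂ (basisFamily U r p) c) (mon U (a₀ + x.1) (b₀ + x.2)) = 0)
    (y : ℕ × ℕ) : c ((d, j), y) = 0 := by
  classical
  by_contra hy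
  refine hy (eq_zero_of_sum_eq_zero D hD (a₀ - p / 2) b₀ (fun y => c ((d, j), y)) (fun x hx => ?_)
    (hc y hy))
  set a := a₀ + x.1 with ha
  set b := b₀ + x.2 with hb
  have hpos := (isHom_lead (U := U) (r := r) (p := p) d j a b).1 (hlead x hx)
  have h0 : (Finsupp.linearCombination ℂ (basisFamily U r p) c) (mon U a b) = 0 := h x hx
  -- Reading off the coefficient at the target exponent isolates the terms of bidegree `(d,-j)`;
  -- dividing by the nonzero `leadCoeff` leaves a polynomial with exponents in `D`.
  have h1 := congrArg (fun g => monRepr hU g ((a + d).toNat, (b + -(j : ℤ)).toNat)) h0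
  simp only [map_zero, Finsupp.zero_apply] at h1
  rw [Finsupp.linearCombination_apply, Finsupp.sum, LinearMap.sum_apply, map_sum,
    Finsupp.finsetSum_apply] at h1
  have h2 (z : (ℤ × ℕ) × (ℕ × ℕ)) :
      monRepr hU ((c z • basisFamily U r p z) (mon U a b)) ((a + d).toNat, (b + -(j : ℤ)).toNat) =
        if z.1 = (d, j) then
          leadCoeff r p d j a b * (c z * (((a : ℂ) - p / 2) ^ z.2.1 * (b : ℂ) ^ z.2.2)) else 0 := by
    obtain ⟨⟨d', j'⟩, n, m⟩ := z
    obtain ⟨h3, h4⟩ := isHom_basisMonomial (U := U) (r := r) (p := p) d' j' n m a b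
    dsimp only at h3 h4
    rw [LinearMap.smul_apply, basisFamily, h4, map_smul, map_smul, monRepr_mon, Finsupp.smul_apply,
      Finsupp.smul_apply, smul_eq_mul, smul_eq_mul]
    split_ifs with hz
    · rw [Prod.mk.injEq] at hz
      obtain ⟨rfl, rfl⟩ := hz
      rw [Finsupp.single_eq_same]
      ring
    · by_cases h5 : leadCoeff r p d' j' a b * (((a : ℂ) - p / 2) ^ n * (b : ℂ) ^ m) = 0
      · rw [h5]; simp
      · have h6 := h3 h5
        rw [Finsupp.single_eq_of_ne]
        · simp
        · intro h7
          rw [Prod.mk.injEq] at h7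
          exact hz (Prod.ext (by dsimp only; omega) (by dsimp only; omega))
  simp only [h2] at h1
  have h3 : ∑ y ∈ D, leadCoeff r p d j a b *
      (c ((d, j), y) * (((a : ℂ) - p / 2) ^ y.1 * (b : ℂ) ^ y.2)) = 0 := by
    rw [← h1, ← Finset.sum_filter]
    refine Finset.sum_bij_ne_zero (fun y _ _ => ((d, j), y)) (fun y hy hne => ?_)
      (fun y _ _ z _ _ e => (Prod.mk.inj e).2) (fun z hz hne => ?_) (fun y _ _ => rfl)
    · refine mem_filter.2 ⟨Finsupp.mem_support_iff.2 fun h0 => hne ?_, rfl⟩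
      rw [h0]; simp
    · obtain ⟨z1, z2⟩ := z
      obtain ⟨h4, h5⟩ := mem_filter.1 hz
      dsimp only at h5
      subst h5
      exact ⟨z2, hc z2 (Finsupp.mem_support_iff.1 h4), hne, rfl⟩
  rw [← Finset.mul_sum] at h3
  refine Eq.trans ?_ ((mul_eq_zero.1 h3).resolve_left (hlead x hx))
  refine Finset.sum_congr rfl fun y _ => ?_
  rw [ha, hb]
  push_cast
  ring

theorem linearIndependent_basisFamily (hU : (U : Set (ℂ × ℂ)).Nonempty) :
    LinearIndependent ℂ (basisFamily U r p) := by
  rw [linearIndependent_iff]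
  intro c hc
  ext ⟨⟨d, j⟩, y⟩
  let N := c.support.sup fun z => z.2.1 + z.2.2
  -- With the `x`-exponent above `p` no factor `a + r b - p + h` vanishes, so a triangle of any size
  -- `N` can be used from this corner on.
  refine coefficient_eq_zero hU c d j
    ((range (N + 1) ×ˢ range (N + 1)).filter fun x => x.1 + x.2 ≤ N) ?_ ?_ (lowering d + p + 1) j
    ?_ (fun x _ => by rw [hc, LinearMap.zero_apply]) y
  · intro i j i' j' h h1 h2
    simp only [mem_filter, mem_product, mem_range] at h ⊢
    omega
  · intro y hy
    have : y.1 + y.2 ≤ N := Finset.le_sup (f := fun z : (ℤ × ℕ) × (ℕ × ℕ) => z.2.1 + z.2.2)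
      (Finsupp.mem_support_iff.2 hy)
    simp only [mem_filter, mem_product, mem_range]
    omega
  · intro x _
    exact leadCoeff_ne_zero (by omega) (by omega) fun i _ => by omega

theorem linearIndependent_bigMonomials (hr : 0 < r) (hU : (U : Set (ℂ × ℂ)).Nonempty) (k : ℕ) :
    LinearIndependent ℂ (fun T : bigMonomials U r p k => (T : Op U)) := by
  have h := (linearIndependent_basisFamily (r := r) (p := p) hU).linearIndepOn_id
  refine h.mono ?_
  rw [bigMonomials_eq hr]
  rintro _ ⟨d, j, n, m, -, rfl⟩
  exact ⟨((d, j), (n, m)), rfl⟩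

/-! ### The order of the monomials -/

section Order

open Polynomial

/-- On `x^a y^a` the weight of a monomial is a polynomial in `a` of degree equal to the number of
its factors, while order at most `l` only allows degree at most `l`. -/
theorem le_of_basisMonomial_mem_diffOpLE (hU : (U : Set (ℂ × ℂ)).Nonempty) {d : ℤ} {j n m l : ℕ}
    (h : basisMonomial U r p d j n m ∈ diffOpLE U l) :
    lowering d + raising r d j + j + n + m ≤ l := by
  obtain ⟨z, h1, h2⟩ := exists_mem_ne_zero hU
  obtain ⟨Q, hQ, hQ'⟩ := exists_polynomial_diagonal h z h1 h2
  let R : ℂ[X] := (∏ h ∈ range j, (Polynomial.X - C (h : ℂ))) *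
    (∏ h ∈ range (raising r d j), (C (1 + r : ℂ) * Polynomial.X + C (-p + h : ℂ))) *
    (∏ h ∈ range (lowering d), (Polynomial.X - C (h : ℂ))) *
    ((Polynomial.X - C (p / 2 : ℂ)) ^ n * Polynomial.X ^ m)
  -- On the diagonal `a + r b` becomes `(1 + r) a`, so the factors from `J^2` stay of degree one.
  have hr' : (1 + r : ℂ) ≠ 0 := by
    have : ((1 + r : ℕ) : ℂ) ≠ 0 := Nat.cast_ne_zero.2 (by omega)
    exact_mod_cast this
  have hlin (h : ℂ) : (C (1 + r : ℂ) * Polynomial.X + C h).natDegree = 1 := natDegree_linear hr'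
  have hlin' (h : ℂ) : C (1 + r : ℂ) * Polynomial.X + C h ≠ 0 := fun e => by
    have := hlin h
    rw [e, natDegree_zero] at this
    omega
  have hR : R.natDegree = lowering d + raising r d j + j + n + m := by
    have p1 (s : ℕ) : ∏ h ∈ range s, (Polynomial.X - C (h : ℂ)) ≠ 0 :=
      Finset.prod_ne_zero_iff.2 fun h _ => X_sub_C_ne_zero _
    have p2 (s : ℕ) : ∏ h ∈ range s, (C (1 + r : ℂ) * Polynomial.X + C (-p + h : ℂ)) ≠ 0 :=
      Finset.prod_ne_zero_iff.2 fun h _ => hlin' _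
    have p3 : (Polynomial.X - C (p / 2 : ℂ)) ^ n ≠ 0 := pow_ne_zero _ (X_sub_C_ne_zero _)
    have p4 : (Polynomial.X : ℂ[X]) ^ m ≠ 0 := pow_ne_zero _ X_ne_zero
    have q1 (s : ℕ) : (∏ h ∈ range s, (Polynomial.X - C (h : ℂ))).natDegree = s := by
      rw [natDegree_prod _ _ fun h _ => X_sub_C_ne_zero _]
      simp only [natDegree_X_sub_C, sum_const, card_range, smul_eq_mul, mul_one]
    have q2 (s : ℕ) :
        (∏ h ∈ range s, (C (1 + r : ℂ) * Polynomial.X + C (-p + h : ℂ))).natDegree = s := by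
      rw [natDegree_prod _ _ fun h _ => hlin' _, Finset.sum_congr rfl fun h _ => hlin _]
      simp
    simp only [R]
    rw [natDegree_mul (mul_ne_zero (mul_ne_zero (p1 _) (p2 _)) (p1 _)) (mul_ne_zero p3 p4),
      natDegree_mul (mul_ne_zero (p1 _) (p2 _)) (p1 _), natDegree_mul (p1 _) (p2 _),
      natDegree_mul p3 p4, q1, q1, q2, natDegree_pow, natDegree_X_sub_C, natDegree_X_pow]
    omega
  set K : ℂ := (z : ℂ × ℂ).1 ^ d * (z : ℂ × ℂ).2 ^ (-(j : ℤ)) with hK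
  have hK0 : K ≠ 0 := mul_ne_zero (zpow_ne_zero _ h1) (zpow_ne_zero _ h2)
  -- The two polynomials agree at all natural numbers; `K` records the shift of the exponents at the
  -- point `z`.
  have hEq : Q = C K * R := by
    refine eq_of_infinite_eval_eq _ _ ((Set.infinite_range_of_injective
      (Nat.cast_injective (R := ℂ))).mono ?_)
    rintro _ ⟨a, rfl⟩
    have hmon : (mon U a a).fn z ≠ 0 := by
      rw [fn_mon]
      exact mul_ne_zero (pow_ne_zero _ h1) (pow_ne_zero _ h2)
    refine mul_right_cancel₀ hmon ?_
    rw [← hQ' a]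
    obtain ⟨h3, h4⟩ := isHom_basisMonomial (U := U) (r := r) (p := p) d j n m a a
    dsimp only at h3 h4
    have hval : R.eval (a : ℂ) =
        leadCoeff r p d j a a * (((a : ℂ) - p / 2) ^ n * (a : ℂ) ^ m) := by
      simp only [R, leadCoeff, eval_mul, eval_prod, eval_sub, eval_add, eval_X, eval_C, eval_pow]
      congr 3
      exact Finset.prod_congr rfl fun h _ => by ring
    rw [h4, eval_mul, eval_C, hval, fn_smul]
    by_cases h0 : leadCoeff r p d j a a * (((a : ℂ) - p / 2) ^ n * (a : ℂ) ^ m) = 0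
    · rw [h0]; simp
    · obtain ⟨h5, h6⟩ := h3 h0
      have e1 : (z : ℂ × ℂ).1 ^ (a + d).toNat = (z : ℂ × ℂ).1 ^ a * (z : ℂ × ℂ).1 ^ d := by
        rw [← zpow_natCast, Int.toNat_of_nonneg h5, zpow_add₀ h1, zpow_natCast]
      have e2 : (z : ℂ × ℂ).2 ^ (a + -(j : ℤ)).toNat =
          (z : ℂ × ℂ).2 ^ a * (z : ℂ × ℂ).2 ^ (-(j : ℤ)) := by
        rw [← zpow_natCast, Int.toNat_of_nonneg h6, zpow_add₀ h2, zpow_natCast]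
      rw [fn_mon, fn_mon, e1, e2, hK]
      ring
  rw [hEq, natDegree_C_mul hK0, hR] at hQ
  exact hQ

end Order

theorem hasOrder_basisMonomial_iff (hr : 0 < r) (hU : (U : Set (ℂ × ℂ)).Nonempty) (d : ℤ)
    (j n m k : ℕ) : HasOrder U (basisMonomial U r p d j n m) k ↔
      lowering d + raising r d j + j + n + m = k := by
  have h := basisMonomial_mem_diffOpLE (U := U) (p := p) hr d j n m
  constructor
  · rintro ⟨h1, h2⟩
    refine le_antisymm (le_of_basisMonomial_mem_diffOpLE hU h1) (not_lt.1 fun h3 => h2 _ h3 h)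
  · rintro rfl
    refine ⟨h, fun l hl h' => ?_⟩
    have := le_of_basisMonomial_mem_diffOpLE hU h'
    omega

/-! ### Counting the monomials of top order -/

theorem sum_mul_sub_eq (R K : ℚ) (n : ℕ) :
    ∑ l ∈ range n, (R * l + 1) * (K - l + 1) =
      (K + 1) * n + (R * (K + 1) - 1) * (n * (n - 1) / 2) -
        R * ((n - 1) * n * (2 * n - 1) / 6) := by
  induction n with
  | zero => simp
  | succ n ih => rw [Finset.sum_range_succ, ih]; push_cast; ring

theorem ncard_index (r k : ℕ) :
    ({x : (ℤ × ℕ) × (ℕ × ℕ) |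
      lowering x.1.1 + raising r x.1.1 x.1.2 + x.1.2 + x.2.1 + x.2.2 = k}.ncard : ℚ) = ((k : ℚ) + 1) * (k + 2) * ((r + 2) * k + 3) / 6 := by
  let F : Finset (Σ _ : ℕ, ℕ × ℕ) :=
    (range (k + 1)).sigma fun l => range ((r + 2) * l + 1) ×ˢ range (k - l + 1)
  -- For a leading product of length `l`, the parameter `u` lists `l` cases with `d < 0`, then `l`
  -- cases with `d > r j`, then the `r l + 1` cases `j = l`, `0 ≤ d ≤ r l`. This gives `(r + 2) l +
  -- 1`, times `k - l + 1` choices of `n`.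
  let φ : (Σ _ : ℕ, ℕ × ℕ) → (ℤ × ℕ) × (ℕ × ℕ) := fun x =>
    (if x.2.1 < x.1 then (-((x.1 - x.2.1 : ℕ) : ℤ), x.2.1)
      else if x.2.1 < 2 * x.1 then
        (((r * (x.2.1 - x.1) : ℕ) : ℤ) + ((2 * x.1 - x.2.1 : ℕ) : ℤ), x.2.1 - x.1)
      else (((x.2.1 - 2 * x.1 : ℕ) : ℤ), x.1), (x.2.2, k - x.1 - x.2.2))
  have hlen (x) (hx : x ∈ F) :
      lowering (φ x).1.1 + raising r (φ x).1.1 (φ x).1.2 + (φ x).1.2 = x.1 := by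
    obtain ⟨l, u, n⟩ := x
    simp only [F, mem_sigma, mem_product, mem_range, add_mul] at hx
    simp only [φ, lowering, raising]
    split_ifs <;> dsimp only <;> omega
  have himage : {x : (ℤ × ℕ) × (ℕ × ℕ) |
      lowering x.1.1 + raising r x.1.1 x.1.2 + x.1.2 + x.2.1 + x.2.2 = k} = φ '' F := by
    ext x
    constructor
    · obtain ⟨⟨d, j⟩, n, m⟩ := x
      intro hx
      replace hx : lowering d + raising r d j + j + n + m = k := hx
      rcases lt_or_ge d 0 with hd | hd
      · have h1 : raising r d j = 0 := by simp only [raising]; omega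
        have h2 : (lowering d : ℤ) = -d := by simp only [lowering]; omega
        refine ⟨⟨lowering d + j, j, n⟩, ?_, ?_⟩
        · simp only [F, coe_sigma, Set.mem_sigma_iff, mem_coe, mem_product, mem_range, add_mul]
          omega
        · simp only [φ]
          rw [if_pos (by omega)]
          refine Prod.ext (Prod.ext ?_ rfl) (Prod.ext rfl ?_) <;> dsimp only <;> omega
      have h1 : lowering d = 0 := by simp only [lowering]; omega
      rcases lt_or_ge ((r * j : ℕ) : ℤ) d with hd' | hd'
      · have h2 : (raising r d j : ℤ) = d - (r * j : ℕ) := by simp only [raising]; omega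
        refine ⟨⟨raising r d j + j, raising r d j + j + j, n⟩, ?_, ?_⟩
        · simp only [F, coe_sigma, Set.mem_sigma_iff, mem_coe, mem_product, mem_range, add_mul]
          omega
        · simp only [φ]
          rw [if_neg (by omega), if_pos (by omega), Nat.add_sub_cancel_left]
          refine Prod.ext (Prod.ext ?_ rfl) (Prod.ext rfl ?_) <;> dsimp only <;> omega
      · have h2 : raising r d j = 0 := by simp only [raising]; omega
        refine ⟨⟨j, 2 * j + d.toNat, n⟩, ?_, ?_⟩
        · simp only [F, coe_sigma, Set.mem_sigma_iff, mem_coe, mem_product, mem_range, add_mul]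
          omega
        · simp only [φ]
          rw [if_neg (by omega), if_neg (by omega)]
          refine Prod.ext (Prod.ext ?_ rfl) (Prod.ext rfl ?_) <;> dsimp only <;> omega
    · rintro ⟨x, hx, rfl⟩
      have := hlen x (mem_coe.1 hx)
      obtain ⟨l, u, n⟩ := x
      simp only [F, coe_sigma, Set.mem_sigma_iff, mem_coe, mem_product, mem_range] at hx
      rw [Set.mem_ofPred_eq, this]
      simp only [φ]
      omega
  have hinj : Set.InjOn φ F := by
    intro x hx y hy e
    have h1 := hlen x (mem_coe.1 hx)
    have h2 := hlen y (mem_coe.1 hy)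
    rw [e, h2] at h1
    obtain ⟨l, u, n⟩ := x
    obtain ⟨l', u', n'⟩ := y
    dsimp only at h1
    subst h1
    have hn : n = n' := congrArg (fun z => z.2.1) e
    subst hn
    have h3 : (φ ⟨l', u, n⟩).1 = (φ ⟨l', u', n⟩).1 := congrArg Prod.fst e
    have h4 : (φ ⟨l', u, n⟩).1.1 = (φ ⟨l', u', n⟩).1.1 := congrArg Prod.fst h3
    have h5 : (φ ⟨l', u, n⟩).1.2 = (φ ⟨l', u', n⟩).1.2 := congrArg Prod.snd h3
    have hu : u = u' := by
      simp only [φ] at h4 h5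
      split_ifs at h4 h5 <;> dsimp only at h4 h5 <;> omega
    rw [hu]
  rw [himage, hinj.ncard_image, Set.ncard_coe_finset, Finset.card_sigma]
  push_cast [Finset.card_product, Finset.card_range]
  have h := sum_mul_sub_eq (r + 2) k (k + 1)
  have e : ∑ l ∈ range (k + 1), (((r : ℚ) + 2) * l + 1) * (((k - l : ℕ) : ℚ) + 1) =
      ∑ l ∈ range (k + 1), (((r : ℚ) + 2) * l + 1) * ((k : ℚ) - l + 1) := by
    refine Finset.sum_congr rfl fun l hl => ?_
    rw [Nat.cast_sub (by have := mem_range.1 hl; omega)]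
  rw [e, h]
  push_cast
  ring

theorem ncard_hasOrder (hr : 0 < r) (hU : (U : Set (ℂ × ℂ)).Nonempty) (k : ℕ) :
    ({T ∈ bigMonomials U r p k | HasOrder U T k}.ncard : ℚ) =
      ((k : ℚ) + 1) * (k + 2) * ((r + 2) * k + 3) / 6 := by
  rw [← ncard_index r k, ← Set.ncard_image_of_injective _
    (linearIndependent_basisFamily (r := r) (p := p) hU).injective]
  congr 2
  ext T
  rw [bigMonomials_eq hr]
  constructor
  · rintro ⟨⟨d, j, n, m, -, rfl⟩, h⟩
    exact ⟨((d, j), (n, m)), (hasOrder_basisMonomial_iff hr hU d j n m k).1 h, rfl⟩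
  · rintro ⟨⟨⟨d, j⟩, n, m⟩, h, rfl⟩
    have h : lowering d + raising r d j + j + n + m = k := h
    exact ⟨⟨d, j, n, m, h.le, rfl⟩, (hasOrder_basisMonomial_iff hr hU d j n m k).2 h⟩

/-! ### The projected monomials as a basis of the downward part -/

/-- A nonzero `leadCoeff` leaves room for the shift: `d - r j ≤ raising` keeps the image below the
slanted edge, and the `y`-exponent never grows. -/
theorem basisFamily_mem_preserving (hr : 0 < r) (x : (ℤ × ℕ) × (ℕ × ℕ)) :
    basisFamily U r p x ∈ preserving U r p q := by
  obtain ⟨⟨d, j⟩, n, m⟩ := x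
  refine ⟨basisMonomial_mem_diffOp hr d j n m, map_stair_of_mon fun γ hγ => ?_⟩
  have h2 := (isHom_basisMonomial (U := U) (r := r) (p := p) d j n m γ.1 γ.2).2
  dsimp only at h2
  rw [basisFamily, h2]
  by_cases h0 : leadCoeff r p d j γ.1 γ.2 * (((γ.1 : ℂ) - p / 2) ^ n * (γ.2 : ℂ) ^ m) = 0
  · rw [h0, zero_smul]; exact zero_mem _
  · obtain ⟨h3, h4⟩ := mem_stairPts.1 hγ
    obtain ⟨h5, h6, h7⟩ := bounds_of_leadCoeff_ne_zero h3 (left_ne_zero_of_mul h0)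
    obtain ⟨u, hu⟩ := Nat.exists_eq_add_of_le h6
    refine Submodule.smul_mem _ _ (mon_mem_stair
      (α := ((γ.1 + d).toNat, (γ.2 + -(j : ℤ)).toNat)) (mem_stairPts.2 ⟨?_, by dsimp only; omega⟩))
    have e : (γ.2 + -(j : ℤ)).toNat = u := by omega
    dsimp only
    rw [e]
    rw [hu, mul_add] at h3 h7
    simp only [raising, lowering] at h5 h7
    omega

/-- The exponents `(n, m)` of `J^3`, `J^4` in the monomials of bidegree `(d, -j)`. -/
def exponents (r p q : ℕ) (d : ℤ) (j : ℕ) : Finset (ℕ × ℕ) :=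
  (range (p + 1) ×ˢ range (q + 1)).filter fun y =>
    y.2 + j ≤ q ∧ y.1 + r * y.2 + (lowering d + raising r d j) + j * r ≤ p

theorem mem_exponents {d : ℤ} {j : ℕ} {y : ℕ × ℕ} : y ∈ exponents r p q d j ↔
    y.2 + j ≤ q ∧ y.1 + r * y.2 + (lowering d + raising r d j) + j * r ≤ p := by
  rw [exponents, mem_filter, mem_product, mem_range, mem_range]
  omega

theorem exponents_lower (d : ℤ) (j : ℕ) (i l i' l' : ℕ) (h : (i, l) ∈ exponents r p q d j)
    (hi : i' ≤ i) (hl : l' ≤ l) : (i', l') ∈ exponents r p q d j := by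
  rw [mem_exponents] at h ⊢
  have := Nat.mul_le_mul_left r hl
  dsimp only at *
  omega

theorem add_exponents_mem_stairPts {d : ℤ} {j : ℕ} {x : ℕ × ℕ} (hx : x ∈ exponents r p q d j) :
    (lowering d + x.1, j + x.2) ∈ stairPts r p q := by
  obtain ⟨h1, h2⟩ := mem_exponents.1 hx
  rw [mul_comm j r] at h2
  rw [mem_stairPts]
  dsimp only
  rw [mul_add]
  omega

theorem leadCoeff_add_exponents_ne_zero {d : ℤ} {j : ℕ} {x : ℕ × ℕ}
    (hx : x ∈ exponents r p q d j) :
    leadCoeff r p d j ((lowering d + x.1 : ℕ) : ℂ) ((j + x.2 : ℕ) : ℂ) ≠ 0 := by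
  obtain ⟨h1, h2⟩ := mem_exponents.1 hx
  rw [mul_comm j r] at h2
  refine leadCoeff_ne_zero (by omega) (by omega) fun i hi => ?_
  rw [mul_add]
  omega

/-- The indices of the monomials whose projections form a basis of `𝔖̃^{r↓}_{p,q}`. -/
abbrev EffIndex (r p q : ℕ) : Type :=
  {x : (ℤ × ℕ) × (ℕ × ℕ) // x.2 ∈ exponents r p q x.1.1 x.1.2}

/-- A relation between the projections is a combination of monomials that kills the module. In each
bidegree its polynomial factor has exponents in `exponents` and vanishes on a translate of that set
inside the staircase. -/
theorem linearIndependent_projection (hr : 0 < r) (hU : (U : Set (ℂ × ℂ)).Nonempty)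
    (hc : IsCompl (distinguished U r p q) (LinearMap.ker (restr U r p q))) :
    LinearIndependent ℂ fun x : EffIndex r p q => Submodule.projection _ _ hc
      ⟨basisFamily U r p x.1, basisFamily_mem_preserving hr x.1⟩ := by
  classical
  rw [linearIndependent_iff]
  intro c h
  set S : preserving U r p q := Finsupp.linearCombination ℂ
    (fun x : EffIndex r p q => ⟨basisFamily U r p x.1, basisFamily_mem_preserving hr x.1⟩) c with hS
  have h1 : Submodule.projection _ _ hc S = 0 := by
    rw [hS, Finsupp.apply_linearCombination]
    exact h
  have h2 := mem_ker_restr.1 ((Submodule.projection_apply_eq_zero_iff hc).1 h1)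
  have h3 : (S : Op U) = Finsupp.linearCombination ℂ (basisFamily U r p)
      (c.mapDomain Subtype.val) := by
    rw [← Submodule.subtype_apply, hS, Finsupp.apply_linearCombination,
      Finsupp.linearCombination_mapDomain]
    rfl
  rw [h3] at h2
  ext x
  rw [Finsupp.zero_apply, ← Finsupp.mapDomain_apply Subtype.val_injective c x]
  obtain ⟨⟨⟨d, j⟩, y⟩, hx⟩ := x
  refine coefficient_eq_zero hU _ d j (exponents r p q d j) (exponents_lower d j) (fun y hy => ?_)
    (lowering d) j (fun x hx => leadCoeff_add_exponents_ne_zero hx)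
    (fun x hx => h2 _ (add_exponents_mem_stairPts hx)) y
  obtain ⟨z, -, hz⟩ := Finset.mem_image.1
    (Finsupp.mapDomain_support (Finsupp.mem_support_iff.2 hy))
  have := z.2
  rwa [hz] at this

/-- The matrix unit from `α` to `β` is obtained by interpolation: the polynomial factor must be `1 /
leadCoeff` at `α` and `0` at the other points of the translate, while elsewhere on the staircase
`leadCoeff` already vanishes. -/
theorem stairElem_mem_span (hr : 0 < r)
    (hc : IsCompl (distinguished U r p q) (LinearMap.ker (restr U r p q))) (x : DownPairs r p q) :
    stairElem U r p q x.1.1 x.1.2 ∈ Submodule.span ℂ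
      (Set.range fun x : EffIndex r p q => Submodule.projection _ _ hc
        ⟨basisFamily U r p x.1, basisFamily_mem_preserving hr x.1⟩) := by
  classical
  obtain ⟨⟨⟨α, hα⟩, ⟨β, hβ⟩⟩, hle⟩ := x
  dsimp only at hle ⊢
  obtain ⟨a1, a2⟩ := mem_stairPts.1 hα
  obtain ⟨b1, b2⟩ := mem_stairPts.1 hβ
  set d : ℤ := (β.1 : ℤ) - α.1 with hd
  obtain ⟨j, hj⟩ := Nat.exists_eq_add_of_le hle
  have hα' := a1
  rw [hj, mul_add] at hα'
  have hlow : lowering d ≤ α.1 := by simp only [lowering]; omega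
  set x₀ : ℕ × ℕ := (α.1 - lowering d, β.2) with hx₀
  have hx₀mem : x₀ ∈ exponents r p q d j := by
    rw [mem_exponents, mul_comm j r]
    simp only [x₀, raising, lowering]
    omega
  have hαx : α = (lowering d + x₀.1, j + x₀.2) :=
    Prod.ext (by simp only [x₀]; omega) (by simp only [x₀]; omega)
  obtain ⟨c, hcoef⟩ := exists_interpolation (exponents r p q d j) (exponents_lower d j)
    (lowering d - p / 2) j fun x => if x = x₀ then (leadCoeff r p d j α.1 α.2)⁻¹ else 0
  set S : preserving U r p q := ∑ y ∈ exponents r p q d j, c y •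
    ⟨basisFamily U r p ((d, j), y), basisFamily_mem_preserving hr ((d, j), y)⟩ with hS
  have hSe : Submodule.projection _ _ hc S = stairElem U r p q α ⟨β, hβ⟩ := by
    refine projection_eq_of_sub_mem_ker hc (stairElem_mem_distinguished _ _)
      (mem_ker_restr.2 fun γ hγ => ?_)
    rw [Submodule.coe_sub, LinearMap.sub_apply, stairElem_mon _ _ hγ, sub_eq_zero]
    have hSop : (S : Op U) = ∑ y ∈ exponents r p q d j, c y • basisFamily U r p ((d, j), y) := by
      rw [← Submodule.subtype_apply, hS]
      simp only [map_sum, map_smul, Submodule.subtype_apply]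
    have hSmon : (S : Op U) (mon U γ.1 γ.2) = (leadCoeff r p d j γ.1 γ.2 *
        ∑ y ∈ exponents r p q d j, c y * (((γ.1 : ℂ) - p / 2) ^ y.1 * (γ.2 : ℂ) ^ y.2)) •
          mon U (γ.1 + d).toNat (γ.2 + -(j : ℤ)).toNat := by
      rw [hSop, LinearMap.sum_apply, Finset.mul_sum, Finset.sum_smul]
      refine Finset.sum_congr rfl fun y _ => ?_
      rw [LinearMap.smul_apply, basisFamily, (isHom_basisMonomial d j y.1 y.2 γ.1 γ.2).2, smul_smul]
      congr 1
      ring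
    rw [hSmon]
    by_cases h0 : leadCoeff r p d j γ.1 γ.2 = 0
    · rw [if_neg, h0, zero_mul, zero_smul]
      rintro rfl
      rw [hαx] at h0
      exact leadCoeff_add_exponents_ne_zero hx₀mem h0
    · obtain ⟨g1, g2⟩ := mem_stairPts.1 hγ
      obtain ⟨h5, h6, h7⟩ := bounds_of_leadCoeff_ne_zero g1 h0
      obtain ⟨u, hu⟩ := Nat.exists_eq_add_of_le h5
      obtain ⟨v, hv⟩ := Nat.exists_eq_add_of_le h6
      have hmem : (u, v) ∈ exponents r p q d j := by
        rw [hu, hv, mul_add] at h7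
        rw [mem_exponents, mul_comm j r]
        dsimp only
        omega
      have hval := hcoef (u, v) hmem
      have e1 : (lowering d - p / 2 + u : ℂ) = γ.1 - p / 2 := by rw [hu]; push_cast; ring
      have e2 : (j + v : ℂ) = γ.2 := by rw [hv]; push_cast; ring
      dsimp only at hval
      rw [e1, e2] at hval
      rw [hval]
      by_cases hγα : γ = α
      · subst hγα
        have hx : (u, v) = x₀ := Prod.ext (by simp only [x₀]; omega) (by simp only [x₀]; omega)
        rw [if_pos hx, if_pos rfl, mul_inv_cancel₀ h0, one_smul]
        congr 1 <;> dsimp only <;> omega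
      · have hx : (u, v) ≠ x₀ := by
          intro hx
          have hx1 : u = x₀.1 := congrArg Prod.fst hx
          have hx2 : v = x₀.2 := congrArg Prod.snd hx
          exact hγα (by rw [hαx]; exact Prod.ext (by rw [hu, hx1]) (by rw [hv, hx2]))
        rw [if_neg hx, if_neg hγα, mul_zero, zero_smul]
  rw [← hSe, hS, map_sum]
  refine sum_mem fun y hy => ?_
  rw [map_smul]
  exact Submodule.smul_mem _ _ (Submodule.subset_span ⟨⟨((d, j), y), hy⟩, rfl⟩)

theorem span_projection (hr : 0 < r) (hU : (U : Set (ℂ × ℂ)).Nonempty)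
    (hc : IsCompl (distinguished U r p q) (LinearMap.ker (restr U r p q))) :
    Submodule.span ℂ (Set.range fun x : EffIndex r p q => Submodule.projection _ _ hc
      ⟨basisFamily U r p x.1, basisFamily_mem_preserving hr x.1⟩) = distinguishedDown U r p q := by
  refine le_antisymm (Submodule.span_le.2 ?_) ?_
  · rintro _ ⟨x, rfl⟩
    exact projection_mem_distinguishedDown hU hc _ (by omega)
      (isHom_basisMonomial x.1.1.1 x.1.1.2 x.1.2.1 x.1.2.2).hasBidegree
  · rw [distinguishedDown_eq_span hU]
    refine Submodule.span_le.2 ?_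
    rintro _ ⟨x, rfl⟩
    exact stairElem_mem_span hr hc x

theorem exists_index_of_mem_effMonomials (hr : 0 < r) (T : effMonomials U r p q) :
    ∃ x : EffIndex r p q, basisFamily U r p x.1 = T := by
  obtain ⟨T, hT⟩ := T
  rw [effMonomials_eq hr] at hT
  obtain ⟨d, j, n, m, h1, h2, rfl⟩ := hT
  exact ⟨⟨((d, j), (n, m)), mem_exponents.2 ⟨h1, h2⟩⟩, rfl⟩

theorem effMonomials_basis (hr : 0 < r) (hU : (U : Set (ℂ × ℂ)).Nonempty) :
    ∃ (hM : ∀ T ∈ effMonomials U r p q, T ∈ preserving U r p q)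
      (hc : IsCompl (distinguished U r p q) (LinearMap.ker (restr U r p q))),
      LinearIndependent ℂ (fun T : effMonomials U r p q =>
        Submodule.projection _ _ hc ⟨T, hM T T.2⟩) ∧
      Submodule.span ℂ (Set.range fun T : effMonomials U r p q =>
        Submodule.projection _ _ hc ⟨T, hM T T.2⟩) = distinguishedDown U r p q := by
  choose idx hidx using exists_index_of_mem_effMonomials (U := U) (p := p) (q := q) hr
  refine ⟨fun T hT => ?_, isCompl_distinguished, ?_, ?_⟩
  · have := hidx ⟨T, hT⟩
    dsimp only at this
    rw [← this]
    exact basisFamily_mem_preserving hr _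
  -- Distinct operators have distinct indices, so independence over indices transfers to the set of
  -- operators even where its description names an operator twice.
  · have hinj : Function.Injective idx := fun S T h => Subtype.ext (by rw [← hidx, ← hidx, h])
    have := (linearIndependent_projection hr hU isCompl_distinguished).comp idx hinj
    convert this using 2 with T
    simp only [Function.comp_apply, hidx]
  · rw [← span_projection hr hU isCompl_distinguished]
    congr 1
    ext S
    constructor
    · rintro ⟨T, rfl⟩
      refine ⟨idx T, ?_⟩
      simp only [hidx]
    · rintro ⟨x, rfl⟩
      obtain ⟨h1, h2⟩ := mem_exponents.1 x.2
      refine ⟨⟨basisFamily U r p x.1, ?_⟩, rfl⟩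
      rw [effMonomials_eq hr]
      exact ⟨_, _, _, _, h1, h2, rfl⟩

end Staircase

end
theorem mainTheorem5 (U : TopologicalSpace.Opens (ℂ × ℂ)) (hU : (U : Set (ℂ × ℂ)).Nonempty)
    (r : ℕ) (hr : 2 ≤ r) (p : ℕ) :
    (∀ q : ℕ,
      (∃ (hM : ∀ T ∈ Staircase.effMonomials U r p q, T ∈ Staircase.preserving U r p q)
        (hc : IsCompl (Staircase.distinguished U r p q)
          (LinearMap.ker (Staircase.restr U r p q))),
        LinearIndependent ℂ (fun T : Staircase.effMonomials U r p q =>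
          Submodule.projection _ _ hc ⟨T, hM T T.2⟩) ∧
        Submodule.span ℂ (Set.range fun T : Staircase.effMonomials U r p q =>
          Submodule.projection _ _ hc ⟨T, hM T T.2⟩) = Staircase.distinguishedDown U r p q) ∧
      (q * r ≤ p →
        FiniteDimensional ℂ (Staircase.distinguishedDown U r p q) ∧
        (Module.finrank ℂ (Staircase.distinguishedDown U r p q) : ℚ) =
          ((q : ℚ) + 1) * (q + 2) / 2 *
            (((p : ℚ) + 1) * (p + 1 - q * r) + (q : ℚ) * r ^ 2 / 12 * (3 * q + 1)))) ∧
    (∀ k : ℕ,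
      LinearMap.range (Staircase.rho U r p k) ≤ Staircase.diffOpLE U k ∧
      LinearIndependent ℂ (fun T : Staircase.bigMonomials U r p k =>
        (T : Staircase.Op U)) ∧
      Submodule.span ℂ (Staircase.bigMonomials U r p k) =
        LinearMap.range (Staircase.rho U r p k) ∧
      ({T ∈ Staircase.bigMonomials U r p k | Staircase.HasOrder U T k}.ncard : ℚ) =
        ((k : ℚ) + 1) * (k + 2) * ((r + 2) * k + 3) / 6) := by
  have hr' : 0 < r := by omega
  refine ⟨fun q => ⟨Staircase.effMonomials_basis hr' hU, fun hq =>
    ⟨Staircase.finiteDimensional_distinguishedDown hU, ?_⟩⟩, fun k =>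
    ⟨Staircase.range_rho_le k, Staircase.linearIndependent_bigMonomials hr' hU k,
      Staircase.span_bigMonomials hr' k, Staircase.ncard_hasOrder hr' hU k⟩⟩
  rw [Staircase.finrank_distinguishedDown hU, Staircase.card_downPairs hq]
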